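/- Consider the elliptic Sitnikov problem $$\ddot x+F(x,t,e)=0,\qquad F(x,t,e)=\frac{x}{\left(x^2+r(t,e)^2\right)^{3/2}},\qquad r(t,e)=\tfrac12\bigl(1-e\cos u(t,e)\bigr),$$ where $e\in[0,1)$ is the eccentricity and $u=u(t,e)$ is the solution of Kepler's equation $u-e\sin u=t$. For $\xi>0$ let $X(t,\xi,e)$ be the solution with $X(0,\xi,e)=\xi$, $\dot X(0,\xi,e)=0$. Let $m,p\ge 1$ be integers. A *family of even $(m,p)$-periodic solutions* emanating from the circular problem ($e=0$) is a family $\varphi_{m,p}(t,e)=X(t,\Xi(e),e)$, $0\le e<e_0$, where $0<e_0\le 1$ and $\Xi:[0,e_0)\to\mathbb R$ is a continuously differentiable function such that $\Xi(0)>0$, the solution $X(\cdot,\Xi(0),0)$ has minimal period $2m\pi/p$, and $\dot X(m\pi,\Xi(e),e)=0$ for all $e\in[0,e_0)$. Let $\tau_{m,p}(e)=\psi_1(2m\pi,e)+\dot\psi_2(2m\pi,e)$ be the trace of the $2m\pi$-Poincaré matrix of the linearized equation $$\ddot y+q(t,e)\,y=0,\qquad q(t,e)=\frac{\partial F}{\partial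 x}\bigl(\varphi_{m,p}(t,e),t,e\bigr),$$ where $\psi_1,\psi_2$ are its solutions with initial values $(\psi_1,\dot\psi_1)(0)=(1,0)$ and $(\psi_2,\dot\psi_2)(0)=(0,1)$. **Theorem 4.3.** Let $1\le p\le\lfloor\sqrt8\,m\rfloor$ and suppose that $\dfrac pm\ne\dfrac1{2n}$ for every integer $n\ge1$. Then a family of even $(m,p)$-periodic solutions as above exists, and for every such family $\tau_{m,p}$ is (one-sidedly) differentiable at $e=0$ with $$\tau_{m,p}'(0)=0.$$ -/

import Mathlib

namespace Sitnikov

/-- `x` is a solution, on the whole time line, of the scalar second order initial value problem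
`ẍ + g(x, t) = 0`, `x(0) = a`, `ẋ(0) = b`. -/
structure IsIVPSolution (g : ℝ → ℝ → ℝ) (a b : ℝ) (x : ℝ → ℝ) : Prop where
  differentiable : Differentiable ℝ x
  ode : ∀ t, HasDerivAt (deriv x) (-(g (x t) t)) t
  init : x 0 = a
  init_deriv : deriv x 0 = b

/-- The solution of `ẍ + g(x, t) = 0`, `x(0) = a`, `ẋ(0) = b`. It is used below only for `g` that are
continuous, and Lipschitz in `x` locally uniformly in `t`, so that there is exactly one solution
on the whole time line. -/
noncomputable def ivpSolution (g : ℝ → ℝ → ℝ) (a b : ℝ) : ℝ → ℝ :=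
  Classical.epsilon (IsIVPSolution g a b)

/-- The trace `ψ₁(T) + ψ₂'(T)` of the `T`-Poincaré matrix of Hill's equation `ÿ + q(t) y = 0`, where
`ψ₁`, `ψ₂` are the fundamental solutions, with initial data `(1, 0)` and `(0, 1)`. -/
noncomputable def hillTrace (q : ℝ → ℝ) (T : ℝ) : ℝ :=
  ivpSolution (fun y t => q t * y) 1 0 T + deriv (ivpSolution (fun y t => q t * y) 0 1) T

/-- `T` is the minimal period of `x`: the least positive period. -/
def HasMinimalPeriod (x : ℝ → ℝ) (T : ℝ) : Prop :=
  IsLeast {S : ℝ | 0 < S ∧ Function.Periodic x S} T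

theorem kepler_bijective {e : ℝ} (he : |e| < 1) :
    Function.Bijective (fun u : ℝ => u - e * Real.sin u) := by
  obtain ⟨h1, h2⟩ := abs_lt.mp he
  have hmono : StrictMono (fun u : ℝ => u - e * Real.sin u) := by
    apply strictMono_of_deriv_pos
    intro u
    have hd : HasDerivAt (fun u : ℝ => u - e * Real.sin u) (1 - e * Real.cos u) u :=
      (hasDerivAt_id u).sub ((Real.hasDerivAt_sin u).const_mul e)
    rw [hd.deriv]
    have hc : |e * Real.cos u| < 1 := by
      rw [abs_mul]
      calc |e| * |Real.cos u| ≤ |e| * 1 :=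
            mul_le_mul_of_nonneg_left (Real.abs_cos_le_one u) (abs_nonneg e)
        _ < 1 := by linarith
    linarith [(abs_lt.mp hc).2]
  have hb : ∀ u : ℝ, |e * Real.sin u| ≤ 1 := fun u => by
    rw [abs_mul]
    calc |e| * |Real.sin u| ≤ 1 * 1 :=
          mul_le_mul he.le (Real.abs_sin_le_one u) (abs_nonneg _) zero_le_one
      _ = 1 := one_mul 1
  refine ⟨hmono.injective, Continuous.surjective (by fun_prop) ?_ ?_⟩
  · refine Filter.tendsto_atTop_mono (f := fun u : ℝ => u - 1) (fun u => ?_)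
      (Filter.tendsto_atTop_add_const_right _ (-1) Filter.tendsto_id)
    linarith [(abs_le.mp (hb u)).2]
  · have h : Filter.Tendsto (fun u : ℝ => u + 1) Filter.atBot Filter.atBot :=
      Filter.tendsto_atBot_add_const_right Filter.atBot (1 : ℝ) Filter.tendsto_id
    refine Filter.tendsto_atBot_mono (fun u => ?_) h
    linarith [(abs_le.mp (hb u)).1]

/-- The solution `u = u(t, e)` of Kepler's equation `u - e sin u = t`. -/
noncomputable def kepler (t e : ℝ) : ℝ :=
  Function.invFun (fun u : ℝ => u - e * Real.sin u) t

theorem kepler_iff {t e u : ℝ} (he : |e| < 1) : kepler t e = u ↔ u - e * Real.sin u = t := by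
  constructor
  · rintro rfl
    exact Function.rightInverse_invFun (kepler_bijective he).surjective t
  · rintro rfl
    exact Function.leftInverse_invFun (kepler_bijective he).injective u

/-- `r(t, e) = r₀ (1 - e cos u(t, e))` with `r₀ = 1 / 2`. -/
noncomputable def radius (t e : ℝ) : ℝ :=
  1 / 2 * (1 - e * Real.cos (kepler t e))

/-- The force term `F(x, t, e) = x / (x² + r(t, e)²) ^ (3 / 2)` of the elliptic Sitnikov problem
`ẍ + F(x, t, e) = 0`. -/
noncomputable def F (x t e : ℝ) : ℝ :=
  x / (x ^ 2 + radius t e ^ 2) ^ (3 / 2 : ℝ)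

/-- `X(t, ξ, e)`: the solution of `ẍ + F(x, t, e) = 0` with `x(0) = ξ`, `ẋ(0) = 0`. -/
noncomputable def X (t ξ e : ℝ) : ℝ :=
  ivpSolution (fun x s => F x s e) ξ 0 t

/-- `Ξ` parametrizes, for eccentricities `e ∈ [0, e₀)`, a family `φ(t, e) = X(t, Ξ(e), e)` of even
`2mπ`-periodic solutions of the elliptic Sitnikov problem that emanates from the even solution
`φ(t, 0)` of the circular problem with `φ(0, 0) > 0` and of minimal period `2mπ / p`. -/
structure IsEvenFamily (m p : ℕ) (e₀ : ℝ) (Ξ : ℝ → ℝ) : Prop where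
  pos : 0 < e₀
  le_one : e₀ ≤ 1
  contDiffOn : ContDiffOn ℝ 1 Ξ (Set.Ico 0 e₀)
  start_pos : 0 < Ξ 0
  start_period : HasMinimalPeriod (fun t => X t (Ξ 0) 0) (2 * m * Real.pi / p)
  deriv_eq_zero : ∀ e ∈ Set.Ico 0 e₀, deriv (fun t => X t (Ξ e) e) (m * Real.pi) = 0

/-- The trace `τ(e)` of the `2mπ`-Poincaré matrix of the linearization `ÿ + q(t, e) y = 0`,
`q(t, e) = ∂F/∂x (φ(t, e), t, e)`, of the Sitnikov equation along `φ(t, e) = X(t, Ξ(e), e)`. -/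
noncomputable def trace (m : ℕ) (Ξ : ℝ → ℝ) (e : ℝ) : ℝ :=
  hillTrace (fun t => deriv (fun x => F x t e) (X t (Ξ e) e)) (2 * m * Real.pi)

end Sitnikov

/-! Existence. For e = 0 the equation is an autonomous odd oscillator. Small oscillations have
frequency close to √8 and large ones are arbitrarily slow, so some amplitude ξ first reaches zero at
time s = mπ/(2p) (`exists_isQuarterPeriod`), and then 4s is the minimal period. Since F/x exceeds
∂F/∂x, Sturm comparison gives ψ₁(s) > 0, and each shift by 2s then changes ψ̇₁ by the same amount up
to an alternating sign. Hence ψ̇₁(mπ) ≠ 0 (`hillVel_nat_mul_ne_zero`), and the implicit function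
theorem continues the even solution to e > 0.

Trace. Put T = 2mπ, x = X(·, Ξ(0), 0), v = ẋ, c = F(x(0)). At e = 0, ψ₂ = -v/c is T-periodic, so the
Poincaré matrix is unipotent with ψ₂(T) = 0. Let α, β be the e-derivatives of ψ₁, ψ₂ along the
family. Differentiating the identity "Wronskian = 1" gives τ'(0) = β(T) ψ̇₁(T) (`variation_trace`),
so it suffices that β(T) = 0.

Let ν be the e-derivative of the velocity along the family. Since ψ₂ is a multiple of v, in w = ν +
cβ all source terms cancel except one: ẅ + qw = -∂ₜ∂ₑF, the derivative taken with x fixed. Here -v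
∂ₜ∂ₑF = ġ sin t with g = -(1/4)(x² + 1/4)^(-3/2). The Wronskian of w and v therefore yields c²β(T) =
-∫₀ᵀ g cos t dt, because w(0) = 0 and ν(T) = 0, every member of the family being at rest at time T.
As g is even in x it has period 2s = mπ/p, so its first harmonic vanishes unless mπ/p ∈ 2πℤ, which
is the excluded case p/m = 1/(2n) (`variation_hillSol_eq_zero`).

Differentiability in (ξ, e) comes from a general theorem on flows of C² fields, applied to the
Sitnikov equation joined with its linearization (`exists_isVariation`). -/

namespace Sitnikov
open Set Filter Topology Function
open scoped NNReal

/-! ### Global existence and smooth dependence on parameters for ODEs -/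

section AbstractODE

variable {E : Type*} [NormedAddCommGroup E] [NormedSpace ℝ E]

/-- A vector field that is globally Lipschitz, uniformly in time, and vanishes at the origin has
solutions on the whole time line. -/
theorem exists_forall_hasDerivAt_of_lipschitz [CompleteSpace E] {f : ℝ → E → E}
    (hf : Continuous (uncurry f)) {K : ℝ≥0} (hK : ∀ t, LipschitzWith K (f t))
    (h0 : ∀ t, f t 0 = 0) (x₀ : E) :
    ∃ z : ℝ → E, z 0 = x₀ ∧ ∀ t, HasDerivAt z (f t (z t)) t := by
  -- Solutions are sought as cosh(lt)·w with w bounded. Integrating the weight gains a factor 1/l,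
  -- so the Picard operator contracts with constant K/(K+1) on the whole line at once.
  set l : ℝ := K + 1 with hl
  have hl0 : 0 < l := by positivity
  have hc : ∀ t, 0 < Real.cosh (l * t) := fun t => Real.cosh_pos _
  have hint : ∀ t, ∫ s in (0 : ℝ)..t, Real.cosh (l * s) = Real.sinh (l * t) / l := by
    intro t
    have := intervalIntegral.integral_eq_sub_of_hasDerivAt (a := 0) (b := t)
      (f := fun s => Real.sinh (l * s) / l) (f' := fun s => Real.cosh (l * s))
      (fun s _ => by
        have := ((Real.hasDerivAt_sinh (l * s)).comp s ((hasDerivAt_id s).const_mul l)).div_const l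
        refine this.congr_deriv ?_
        rw [mul_one, mul_div_cancel_right₀ _ hl0.ne'])
      (Continuous.intervalIntegrable (by fun_prop) _ _)
    simpa using this
  have hsinh : ∀ t, |Real.sinh (l * t)| ≤ Real.cosh (l * t) := fun t => by
    rw [abs_le]
    constructor
    · have := Real.cosh_add_sinh (l * t); have := Real.exp_pos (l * t); linarith
    · exact (Real.sinh_lt_cosh _).le
  have key : ∀ (g : ℝ → E) (C : ℝ) (_ : 0 ≤ C) (_ : ∀ s, ‖g s‖ ≤ C * Real.cosh (l * s)) (t : ℝ),
      ‖∫ s in (0 : ℝ)..t, g s‖ ≤ C / l * Real.cosh (l * t) := by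
    intro g C hC hg t
    have h1 := intervalIntegral.norm_integral_le_abs_of_norm_le (a := 0) (b := t)
      (μ := MeasureTheory.volume) (f := g) (g := fun s => C * Real.cosh (l * s))
      (Eventually.of_forall fun s => hg s)
      (Continuous.intervalIntegrable (by fun_prop) _ _)
    refine h1.trans ?_
    rw [intervalIntegral.integral_const_mul, hint, abs_mul, abs_div, abs_of_nonneg hC,
      abs_of_pos hl0]
    calc C * (|Real.sinh (l * t)| / l) ≤ C * (Real.cosh (l * t) / l) := by
          gcongr; exact hsinh t
      _ = _ := by ring
  have hcont : ∀ w : ℝ → E, Continuous w →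
      Continuous fun s => f s (Real.cosh (l * s) • w s) := fun w hw =>
    hf.comp (continuous_id.prodMk
      ((Real.continuous_cosh.comp (continuous_const.mul continuous_id)).smul hw))
  have hnorm : ∀ t x, ‖f t x‖ ≤ K * ‖x‖ := fun t x => by
    simpa [h0 t] using (hK t).norm_sub_le x 0
  let op : BoundedContinuousFunction ℝ E → BoundedContinuousFunction ℝ E := fun w =>
    BoundedContinuousFunction.ofNormedAddCommGroup
      (fun t => (Real.cosh (l * t))⁻¹ • (x₀ + ∫ s in (0 : ℝ)..t, f s (Real.cosh (l * s) • w s)))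
      (by
        refine Continuous.smul (Continuous.inv₀ (by fun_prop) fun t => (hc t).ne') ?_
        exact continuous_const.add
          (intervalIntegral.continuous_primitive
            (fun a b => (hcont w w.continuous).intervalIntegrable a b) 0))
      (‖x₀‖ + K * ‖w‖ / l)
      (fun t => by
        have h1 := key (fun s => f s (Real.cosh (l * s) • w s)) (K * ‖w‖) (by positivity)
          (fun s => by
            refine (hnorm _ _).trans ?_
            rw [norm_smul, Real.norm_eq_abs, abs_of_pos (hc s), mul_assoc]
            refine mul_le_mul_of_nonneg_left ?_ K.2
            rw [mul_comm]
            refine mul_le_mul_of_nonneg_right ?_ (hc s).le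
            exact w.norm_coe_le_norm s) t
        rw [norm_smul, norm_inv, Real.norm_eq_abs, abs_of_pos (hc t), inv_mul_le_iff₀ (hc t)]
        refine (norm_add_le _ _).trans ?_
        have h2 : ‖x₀‖ ≤ Real.cosh (l * t) * ‖x₀‖ :=
          le_mul_of_one_le_left (norm_nonneg _) (Real.one_le_cosh _)
        nlinarith [h1, h2])
  have hop : ∀ w t, op w t =
      (Real.cosh (l * t))⁻¹ • (x₀ + ∫ s in (0 : ℝ)..t, f s (Real.cosh (l * s) • w s)) :=
    fun w t => rfl
  have hcontr : ContractingWith ((K : ℝ≥0) / (K + 1)) op := by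
    refine ⟨?_, LipschitzWith.of_dist_le_mul fun w v => ?_⟩
    · rw [div_lt_one (by positivity)]; exact lt_add_one K
    · rw [BoundedContinuousFunction.dist_le (by positivity)]
      intro t
      have h1 := key (fun s => f s (Real.cosh (l * s) • w s) - f s (Real.cosh (l * s) • v s))
        (K * dist w v) (by positivity)
        (fun s => by
          refine ((hK s).norm_sub_le _ _).trans ?_
          rw [← smul_sub, norm_smul, Real.norm_eq_abs, abs_of_pos (hc s), mul_assoc]
          refine mul_le_mul_of_nonneg_left ?_ K.2
          rw [mul_comm, ← dist_eq_norm]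
          refine mul_le_mul_of_nonneg_right ?_ (hc s).le
          exact BoundedContinuousFunction.dist_coe_le_dist s) t
      rw [intervalIntegral.integral_sub ((hcont w w.continuous).intervalIntegrable _ _)
        ((hcont v v.continuous).intervalIntegrable _ _)] at h1
      rw [hop, hop, dist_eq_norm, ← smul_sub, norm_smul, norm_inv, Real.norm_eq_abs,
        abs_of_pos (hc t), inv_mul_le_iff₀ (hc t), add_sub_add_left_eq_sub]
      refine h1.trans (le_of_eq ?_)
      push_cast
      rw [hl]; ring
  have : Nonempty (BoundedContinuousFunction ℝ E) := ⟨0⟩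
  set w := ContractingWith.fixedPoint op hcontr with hw
  have hfix : op w = w := hcontr.fixedPoint_isFixedPt
  set z : ℝ → E := fun t => Real.cosh (l * t) • w t with hz
  have hz' : z = fun t => x₀ + ∫ s in (0 : ℝ)..t, f s (z s) := by
    funext t
    have : w t = (Real.cosh (l * t))⁻¹ • (x₀ + ∫ s in (0 : ℝ)..t, f s (z s)) := by
      conv_lhs => rw [← hfix]
      exact hop w t
    simp only [hz] at this ⊢
    rw [this, smul_inv_smul₀ (hc t).ne']
  refine ⟨z, ?_, fun t => ?_⟩
  · rw [hz']; simp
  · have h1 : Continuous fun s => f s (z s) := hcont w w.continuous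
    have h2 := (intervalIntegral.integral_hasDerivAt_right (h1.intervalIntegrable 0 t)
      (h1.stronglyMeasurableAtFilter _ _) h1.continuousAt).const_add x₀
    conv => enter [1]; rw [hz']
    exact h2

/-- Grönwall's inequality for two trajectories, when a Lipschitz estimate is known only in a tube
around the first one. -/
theorem norm_sub_le_of_forall_tube {V : E → E} {z w : ℝ → E} {T K δ : ℝ} (hK : 0 ≤ K)
    (hz : ∀ t ∈ Icc 0 T, HasDerivAt z (V (z t)) t) (hw : ∀ t ∈ Icc 0 T, HasDerivAt w (V (w t)) t)
    (hV : ∀ t ∈ Icc 0 T, ∀ y, ‖y - z t‖ ≤ δ → ‖V y - V (z t)‖ ≤ K * ‖y - z t‖)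
    (h : ‖w 0 - z 0‖ * Real.exp (K * T) < δ) :
    ∀ t ∈ Icc 0 T, ‖w t - z t‖ ≤ ‖w 0 - z 0‖ * Real.exp (K * T) := by
  have hcont : ContinuousOn (fun t => w t - z t) (Icc 0 T) := fun t ht =>
    ((hw t ht).sub (hz t ht)).continuousAt.continuousWithinAt
  have key : ∀ t₁ ∈ Icc 0 T, (∀ t ∈ Ico 0 t₁, ‖w t - z t‖ ≤ δ) →
      ‖w t₁ - z t₁‖ ≤ ‖w 0 - z 0‖ * Real.exp (K * T) := by
    intro t₁ ht₁ htube
    have hsub : Icc 0 t₁ ⊆ Icc 0 T := Icc_subset_Icc_right ht₁.2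
    have := norm_le_gronwallBound_of_norm_deriv_right_le (f := fun t => w t - z t)
      (f' := fun t => V (w t) - V (z t)) (δ := ‖w 0 - z 0‖) (K := K) (ε := 0) (a := 0) (b := t₁)
      (hcont.mono hsub)
      (fun t ht => ((hw t (hsub (Ico_subset_Icc_self ht))).sub
        (hz t (hsub (Ico_subset_Icc_self ht)))).hasDerivWithinAt)
      le_rfl
      (fun t ht => by
        simpa using hV t (hsub (Ico_subset_Icc_self ht)) (w t) (htube t ht))
      t₁ (right_mem_Icc.2 ht₁.1)
    rw [gronwallBound_ε0] at this
    refine this.trans ?_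
    gcongr
    linarith [ht₁.2]
  -- At a first exit time the Grönwall bound still holds, and it lies strictly below δ.
  have htube : ∀ t ∈ Icc 0 T, ‖w t - z t‖ < δ := by
    by_contra! hcon
    obtain ⟨t, ht, htδ⟩ := hcon
    have hcomp : IsCompact {t ∈ Icc 0 T | δ ≤ ‖w t - z t‖} := by
      refine isCompact_Icc.of_isClosed_subset ?_ (fun t ht => ht.1)
      exact (hcont.norm.preimage_isClosed_of_isClosed isClosed_Icc isClosed_Ici)
    obtain ⟨t₁, ht₁, hleast⟩ := hcomp.exists_isLeast ⟨t, ht, htδ⟩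
    have := key t₁ ht₁.1 (fun s hs => by
      by_contra! hs'
      exact absurd (hleast ⟨⟨hs.1, hs.2.le.trans ht₁.1.2⟩, hs'.le⟩) (not_le.2 hs.2))
    linarith [ht₁.2]
  exact fun t ht => key t ht fun s hs => (htube s ⟨hs.1, hs.2.le.trans ht.2⟩).le

/-- Strict differentiability at each point and continuity of the derivative give the estimate
locally; compactness of `C` makes it uniform. -/
theorem eventually_forall_norm_sub_sub_fderiv_le {V : E → E} {U C : Set E} (hU : IsOpen U)
    (hV : ContDiffOn ℝ 1 V U) (hC : IsCompact C) (hCU : C ⊆ U) {ε : ℝ} (hε : 0 < ε) :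
    ∀ᶠ h in 𝓝 (0 : E), ∀ x ∈ C, ‖V (x + h) - V x - fderiv ℝ V x h‖ ≤ ε * ‖h‖ := by
  refine hC.eventually_forall_of_forall_eventually fun x hx => ?_
  have hcd : ContDiffAt ℝ 1 V x := hV.contDiffAt (hU.mem_nhds (hCU hx))
  have h1 := (hcd.hasStrictFDerivAt one_ne_zero).isLittleO.def (half_pos hε)
  have h2 : Tendsto (fun z : E × E => (z.2 + z.1, z.2)) (𝓝 (0, x)) (𝓝 (x, x)) := by
    have : Continuous fun z : E × E => (z.2 + z.1, z.2) := by fun_prop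
    simpa using this.tendsto (0, x)
  have h3 : ContinuousAt (fderiv ℝ V) x :=
    (hcd.fderiv_right (m := 0) (by norm_num)).continuousAt
  have h4 : ∀ᶠ z : E × E in 𝓝 (0, x), ‖fderiv ℝ V z.2 - fderiv ℝ V x‖ < ε / 2 := by
    have h5 : Tendsto (fun z : E × E => fderiv ℝ V z.2) (𝓝 (0, x)) (𝓝 (fderiv ℝ V x)) :=
      h3.tendsto.comp (continuous_snd.tendsto (0, x))
    filter_upwards [h5 (Metric.ball_mem_nhds _ (half_pos hε))] with z hz
    simpa [dist_eq_norm] using hz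
  filter_upwards [h2.eventually h1, h4] with z hz1 hz2
  simp only [add_sub_cancel_left] at hz1
  have h6 : V (z.2 + z.1) - V z.2 - fderiv ℝ V z.2 z.1 =
      (V (z.2 + z.1) - V z.2 - fderiv ℝ V x z.1) - (fderiv ℝ V z.2 - fderiv ℝ V x) z.1 := by
    simp
  rw [h6]
  refine (norm_sub_le _ _).trans ?_
  have h7 := (fderiv ℝ V z.2 - fderiv ℝ V x).le_opNorm z.1
  have h8 : ‖fderiv ℝ V z.2 - fderiv ℝ V x‖ * ‖z.1‖ ≤ ε / 2 * ‖z.1‖ := by gcongr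
  linarith

theorem exists_norm_fderiv_le {V : E → E} {U C : Set E} (hU : IsOpen U)
    (hV : ContDiffOn ℝ 1 V U) (hC : IsCompact C) (hCU : C ⊆ U) :
    ∃ K : ℝ, 0 ≤ K ∧ ∀ x ∈ C, ‖fderiv ℝ V x‖ ≤ K := by
  have hcont : ContinuousOn (fderiv ℝ V) C :=
    (hV.continuousOn_fderiv_of_isOpen hU le_rfl).mono hCU
  obtain ⟨K, hK⟩ := hC.exists_bound_of_continuousOn hcont
  exact ⟨max K 0, le_max_right _ _, fun x hx => (hK x hx).trans (le_max_left _ _)⟩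

/-- Locally Lipschitz dependence of trajectories on their initial values. -/
theorem exists_norm_sub_le_mul {V : E → E} {U : Set E} (hU : IsOpen U)
    (hV : ContDiffOn ℝ 1 V U) {T : ℝ} {z : ℝ → E}
    (hz : ∀ t ∈ Icc 0 T, HasDerivAt z (V (z t)) t) (hzU : ∀ t ∈ Icc 0 T, z t ∈ U) :
    ∃ C > 0, ∃ δ > 0, ∀ w : ℝ → E, (∀ t ∈ Icc 0 T, HasDerivAt w (V (w t)) t) →
      ‖w 0 - z 0‖ < δ → ∀ t ∈ Icc 0 T, ‖w t - z t‖ ≤ C * ‖w 0 - z 0‖ := by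
  have hcomp : IsCompact (z '' Icc 0 T) := isCompact_Icc.image_of_continuousOn
    fun t ht => (hz t ht).continuousAt.continuousWithinAt
  have hsub : z '' Icc 0 T ⊆ U := by rintro _ ⟨t, ht, rfl⟩; exact hzU t ht
  obtain ⟨K, hK0, hK⟩ := exists_norm_fderiv_le hU hV hcomp hsub
  obtain ⟨δ, hδ, hδ'⟩ := Metric.eventually_nhds_iff.1
    (eventually_forall_norm_sub_sub_fderiv_le hU hV hcomp hsub one_pos)
  refine ⟨Real.exp ((K + 1) * T), Real.exp_pos _, δ / 2 / Real.exp ((K + 1) * T), by positivity,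
    fun w hw h t ht => ?_⟩
  rw [mul_comm]
  refine norm_sub_le_of_forall_tube (δ := δ / 2) (by positivity) hz hw (fun t ht y hy => ?_) ?_ t ht
  · have h1 := hδ' (y := y - z t) (by rw [dist_zero_right]; linarith) (z t) ⟨t, ht, rfl⟩
    rw [add_sub_cancel] at h1
    have h2 := ((fderiv ℝ V (z t)).le_opNorm (y - z t)).trans
      (mul_le_mul_of_nonneg_right (hK _ ⟨t, ht, rfl⟩) (norm_nonneg _))
    have h3 := norm_add_le (V y - V (z t) - fderiv ℝ V (z t) (y - z t))
      (fderiv ℝ V (z t) (y - z t))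
    rw [sub_add_cancel] at h3
    linarith
  · rwa [lt_div_iff₀ (Real.exp_pos _)] at h

/-- Extending `A` by its end values makes the field bounded and globally Lipschitz, and gives
two-sided derivatives at the endpoints. -/
theorem exists_hasDerivAt_linear [CompleteSpace E] {A : ℝ → E →L[ℝ] E} {T : ℝ} (hT : 0 ≤ T)
    (hA : ContinuousOn A (Icc 0 T)) (x₀ : E) :
    ∃ y : ℝ → E, y 0 = x₀ ∧ ∀ t ∈ Icc 0 T, HasDerivAt y (A t (y t)) t := by
  set B : ℝ → E →L[ℝ] E := IccExtend hT (domRestrict (Icc 0 T) A) with hB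
  have hBc : Continuous B := (continuousOn_iff_continuous_domRestrict.1 hA).Icc_extend'
  obtain ⟨K, hK⟩ := isCompact_Icc.exists_bound_of_continuousOn hA
  have hBK : ∀ t, ‖B t‖ ≤ max K 0 := fun t =>
    (hK _ (projIcc 0 T hT t).2).trans (le_max_left _ _)
  obtain ⟨y, hy0, hy⟩ := exists_forall_hasDerivAt_of_lipschitz (f := fun t x => B t x)
    (K := (max K 0).toNNReal)
    (by
      have : Continuous fun p : ℝ × E => B p.1 p.2 :=
        (hBc.comp continuous_fst).clm_apply continuous_snd
      exact this)
    (fun t => LipschitzWith.weaken (B t).lipschitz (by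
      rw [← NNReal.coe_le_coe, coe_nnnorm, Real.coe_toNNReal _ (le_max_right _ _)]
      exact hBK t))
    (fun t => by simp) x₀
  refine ⟨y, hy0, fun t ht => ?_⟩
  have : B t = A t := by rw [hB, IccExtend_of_mem hT _ ht]; rfl
  rw [← this]; exact hy t

variable {P : Type*} [NormedAddCommGroup P] [NormedSpace ℝ P]

/-- Differentiability of trajectories in a parameter on which the initial value depends affinely;
the derivative solves the variational equation. -/
theorem hasFDerivAt_trajectory {V : E → E} {U : Set E} (hU : IsOpen U)
    (hV : ContDiffOn ℝ 1 V U) {N : Set P} (hN : IsOpen N) {T : ℝ} {z : P → ℝ → E} (L : P →L[ℝ] E)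
    (hz : ∀ p ∈ N, ∀ t ∈ Icc 0 T, HasDerivAt (z p) (V (z p t)) t)
    (hzU : ∀ p ∈ N, ∀ t ∈ Icc 0 T, z p t ∈ U)
    (hz0 : ∀ p ∈ N, ∀ q ∈ N, z p 0 - z q 0 = L (p - q))
    {p : P} (hp : p ∈ N) {Y : ℝ → P →L[ℝ] E} (hY0 : Y 0 = L)
    (hY : ∀ t ∈ Icc 0 T, HasDerivAt Y (fderiv ℝ V (z p t) ∘L Y t) t) {t : ℝ} (ht : t ∈ Icc 0 T) :
    HasFDerivAt (fun q => z q t) (Y t) p := by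
  have hcomp : IsCompact (z p '' Icc 0 T) := isCompact_Icc.image_of_continuousOn
    fun t ht => (hz p hp t ht).continuousAt.continuousWithinAt
  have hsub : z p '' Icc 0 T ⊆ U := by rintro _ ⟨t, ht, rfl⟩; exact hzU p hp t ht
  obtain ⟨K, hK0, hK⟩ := exists_norm_fderiv_le hU hV hcomp hsub
  obtain ⟨C, hC, δ, hδ, hCδ⟩ := exists_norm_sub_le_mul hU hV (hz p hp) (hzU p hp)
  have hT : 0 ≤ T := ht.1.trans ht.2
  set G := gronwallBound 0 K 1 t with hG
  have hG0 : 0 ≤ G := by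
    have := gronwallBound_mono (δ := 0) (ε := 1) (K := K) le_rfl zero_le_one hK0 ht.1
    rwa [gronwallBound_x0] at this
  set M := C * (‖L‖ + 1) with hM
  have hM0 : 0 < M := by positivity
  rw [hasFDerivAt_iff_isLittleO]
  refine Asymptotics.IsLittleO.of_bound fun c hc => ?_
  -- `G` is the Grönwall bound for unit forcing and `M` the Lipschitz constant in the parameter;
  -- with this ε the remainder ends up below c‖q - p‖.
  set ε := c / ((G + 1) * M) with hε
  have hε0 : 0 < ε := by positivity
  obtain ⟨ρ, hρ, hρ'⟩ := Metric.eventually_nhds_iff.1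
    (eventually_forall_norm_sub_sub_fderiv_le hU hV hcomp hsub hε0)
  have hsmall : ∀ᶠ q in 𝓝 p, (‖L‖ + 1) * ‖q - p‖ < min δ (ρ / C) := by
    have : Tendsto (fun q : P => (‖L‖ + 1) * ‖q - p‖) (𝓝 p) (𝓝 ((‖L‖ + 1) * ‖p - p‖)) :=
      Continuous.tendsto (by fun_prop) p
    refine this.eventually_lt_const ?_
    simp only [sub_self, norm_zero, mul_zero]
    positivity
  filter_upwards [hsmall, hN.mem_nhds hp] with q hq hqN
  have hq0 : ‖z q 0 - z p 0‖ ≤ (‖L‖ + 1) * ‖q - p‖ := by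
    rw [hz0 q hqN p hp]
    refine (L.le_opNorm _).trans ?_
    gcongr; linarith
  have hdist : ∀ s ∈ Icc 0 T, ‖z q s - z p s‖ ≤ M * ‖q - p‖ := fun s hs => by
    refine (hCδ (z q) (hz q hqN) (hq0.trans_lt (hq.trans_le (min_le_left _ _))) s hs).trans ?_
    rw [hM, mul_assoc]; gcongr
  have hMρ : M * ‖q - p‖ < ρ := by
    have := hq.trans_le (min_le_right _ _)
    rw [lt_div_iff₀ hC] at this
    calc M * ‖q - p‖ = (‖L‖ + 1) * ‖q - p‖ * C := by rw [hM]; ring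
      _ < ρ := this
  have hgr := norm_le_gronwallBound_of_norm_deriv_right_le (a := 0) (b := t)
    (f := fun s => z q s - z p s - Y s (q - p))
    (f' := fun s => V (z q s) - V (z p s) - (fderiv ℝ V (z p s) ∘L Y s) (q - p))
    (δ := 0) (K := K) (ε := ε * (M * ‖q - p‖))
    (fun s hs => by
      have hs' : s ∈ Icc 0 T := ⟨hs.1, hs.2.trans ht.2⟩
      exact (((hz q hqN s hs').sub (hz p hp s hs')).sub
        ((hY s hs').clm_apply (hasDerivAt_const s (q - p)))).continuousAt.continuousWithinAt)
    (fun s hs => by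
      have hs' : s ∈ Icc 0 T := ⟨hs.1, hs.2.le.trans ht.2⟩
      have := (((hz q hqN s hs').sub (hz p hp s hs')).sub
        ((hY s hs').clm_apply (hasDerivAt_const s (q - p)))).hasDerivWithinAt (s := Ici s)
      rw [map_zero, add_zero] at this
      exact this)
    (by simp [hY0, hz0 q hqN p hp])
    (fun s hs => by
      have hs' : s ∈ Icc 0 T := ⟨hs.1, hs.2.le.trans ht.2⟩
      have h1 := hρ' (y := z q s - z p s) (by
        rw [dist_zero_right]; exact (hdist s hs').trans_lt hMρ) (z p s) ⟨s, hs', rfl⟩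
      rw [add_sub_cancel] at h1
      have h2 : V (z q s) - V (z p s) - (fderiv ℝ V (z p s) ∘L Y s) (q - p) =
          (V (z q s) - V (z p s) - fderiv ℝ V (z p s) (z q s - z p s)) +
          fderiv ℝ V (z p s) (z q s - z p s - Y s (q - p)) := by
        simp only [map_sub, ContinuousLinearMap.comp_apply]; abel
      rw [h2]
      refine (norm_add_le _ _).trans ?_
      have h3 := ((fderiv ℝ V (z p s)).le_opNorm (z q s - z p s - Y s (q - p))).trans
        (mul_le_mul_of_nonneg_right (hK _ ⟨s, hs', rfl⟩) (norm_nonneg _))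
      have h4 : ε * ‖z q s - z p s‖ ≤ ε * (M * ‖q - p‖) := by
        gcongr; exact hdist s hs'
      linarith)
    t (right_mem_Icc.2 ht.1)
  have hlin : ∀ a, gronwallBound 0 K a (t - 0) = a * G := by
    intro a
    rw [hG, sub_zero]
    unfold gronwallBound
    split_ifs <;> ring
  rw [hlin] at hgr
  refine hgr.trans ?_
  calc ε * (M * ‖q - p‖) * G = c * ‖q - p‖ * (G / (G + 1)) := by rw [hε]; field_simp
    _ ≤ c * ‖q - p‖ * 1 := by
        gcongr
        rw [div_le_one (by positivity)]; linarith
    _ = c * ‖q - p‖ := mul_one _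

/-- For a `C²` vector field, trajectories are continuously differentiable in a parameter on which
their initial value depends affinely. -/
theorem exists_variational_solution [CompleteSpace E] {V : E → E} {U : Set E} (hU : IsOpen U)
    (hV : ContDiffOn ℝ 2 V U) {N : Set P} (hN : IsOpen N) {T : ℝ} (hT : 0 ≤ T) {z : P → ℝ → E}
    (L : P →L[ℝ] E)
    (hz : ∀ p ∈ N, ∀ t ∈ Icc 0 T, HasDerivAt (z p) (V (z p t)) t)
    (hzU : ∀ p ∈ N, ∀ t ∈ Icc 0 T, z p t ∈ U)
    (hz0 : ∀ p ∈ N, ∀ q ∈ N, z p 0 - z q 0 = L (p - q)) :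
    ∃ Y : P → ℝ → P →L[ℝ] E, (∀ p ∈ N, Y p 0 = L) ∧
      (∀ p ∈ N, ∀ t ∈ Icc 0 T, HasDerivAt (Y p) (fderiv ℝ V (z p t) ∘L Y p t) t) ∧
      (∀ p ∈ N, ∀ t ∈ Icc 0 T, HasFDerivAt (fun q => z q t) (Y p t) p) ∧
      ∀ t ∈ Icc 0 T, ContDiffOn ℝ 1 (fun q => z q t) N := by
  have hV1 : ContDiffOn ℝ 1 V U := hV.of_le (by norm_num)
  have hV' : ContDiffOn ℝ 1 (fderiv ℝ V) U := hV.fderiv_of_isOpen hU (by norm_num)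
  have hex : ∀ p : P, ∃ Y : ℝ → P →L[ℝ] E, p ∈ N → Y 0 = L ∧
      ∀ t ∈ Icc 0 T, HasDerivAt Y (fderiv ℝ V (z p t) ∘L Y t) t := by
    intro p
    by_cases hp : p ∈ N
    · have hA : ContinuousOn (fun t => (ContinuousLinearMap.compL ℝ P E E) (fderiv ℝ V (z p t)))
          (Icc 0 T) := by
        refine (ContinuousLinearMap.continuous _).comp_continuousOn ?_
        exact hV'.continuousOn.comp
          (fun t ht => (hz p hp t ht).continuousAt.continuousWithinAt) (hzU p hp)
      obtain ⟨Y, h0, h1⟩ := exists_hasDerivAt_linear hT hA L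
      exact ⟨Y, fun _ => ⟨h0, fun t ht => by simpa using h1 t ht⟩⟩
    · exact ⟨0, fun h => absurd h hp⟩
  choose Y hY using hex
  have hder : ∀ p ∈ N, ∀ t ∈ Icc 0 T, HasFDerivAt (fun q => z q t) (Y p t) p := fun p hp t ht =>
    hasFDerivAt_trajectory hU hV1 hN L hz hzU hz0 hp (hY p hp).1 (hY p hp).2 ht
  refine ⟨Y, fun p hp => (hY p hp).1, fun p hp => (hY p hp).2, hder, fun t ht => ?_⟩
  have hcont : ContinuousOn (fun p => Y p t) N := by
    intro p hp
    -- A trajectory paired with its variational solution is a trajectory of `V₂`, which is C¹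
    -- because V is C². Lipschitz dependence for `V₂` makes the derivative continuous in the
    -- parameter.
    let V₂ : E × (P →L[ℝ] E) → E × (P →L[ℝ] E) := fun x => (V x.1, fderiv ℝ V x.1 ∘L x.2)
    have hV₂ : ContDiffOn ℝ 1 V₂ (U ×ˢ univ) := by
      refine (hV1.comp contDiffOn_fst fun x hx => hx.1).prodMk ?_
      exact (hV'.comp contDiffOn_fst fun x hx => hx.1).clm_comp contDiffOn_snd
    have hsol : ∀ q ∈ N, ∀ t ∈ Icc 0 T,
        HasDerivAt (fun s => (z q s, Y q s)) (V₂ (z q t, Y q t)) t := fun q hq t ht =>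
      (hz q hq t ht).prodMk ((hY q hq).2 t ht)
    obtain ⟨C, hC, δ, hδ, hCδ⟩ := exists_norm_sub_le_mul (hU.prod isOpen_univ) hV₂ (hsol p hp)
      (fun t ht => ⟨hzU p hp t ht, mem_univ _⟩)
    have hinit : ∀ q ∈ N, ‖((z q 0, Y q 0) : E × (P →L[ℝ] E)) - (z p 0, Y p 0)‖ = ‖L (q - p)‖ := by
      intro q hq
      rw [Prod.mk_sub_mk, (hY q hq).1, (hY p hp).1, hz0 q hq p hp, sub_self, Prod.norm_mk,
        norm_zero, max_eq_left (norm_nonneg _)]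
    have hlim : Tendsto (fun q => ‖L (q - p)‖) (𝓝[N] p) (𝓝 0) := by
      have : Continuous fun q => ‖L (q - p)‖ := by fun_prop
      simpa using (this.tendsto p).mono_left (nhdsWithin_le_nhds (s := N))
    refine tendsto_iff_norm_sub_tendsto_zero.2 ?_
    refine squeeze_zero' (Eventually.of_forall fun _ => norm_nonneg _) ?_
      (by simpa using hlim.const_mul C)
    filter_upwards [hlim.eventually_lt_const hδ, self_mem_nhdsWithin] with q hq hqN
    have h1 := hCδ _ (hsol q hqN) (by rw [hinit q hqN]; exact hq) t ht
    rw [hinit q hqN] at h1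
    simpa using (norm_snd_le _).trans h1
  rw [show (1 : WithTop ℕ∞) = 0 + 1 from (zero_add 1).symm,
    contDiffOn_succ_iff_hasFDerivWithinAt_of_uniqueDiffOn hN.uniqueDiffOn]
  exact ⟨by simp, fun p => Y p t, contDiffOn_zero.2 hcont,
    fun p hp => (hder p hp t ht).hasFDerivWithinAt⟩

end AbstractODE

/-! ### Scalar second order equations as first order systems -/

section SecondOrder

theorem lipschitzWith_firstOrder {g : ℝ → ℝ → ℝ} {K : ℝ≥0}
    (hK : ∀ t, LipschitzWith K fun x => g x t) (t : ℝ) :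
    LipschitzWith (max 1 K) fun z : ℝ × ℝ => (z.2, -g z.1 t) := by
  have h1 : LipschitzWith 1 fun z : ℝ × ℝ => z.2 := LipschitzWith.prod_snd
  have h2 : LipschitzWith K fun z : ℝ × ℝ => -g z.1 t := by
    have := ((hK t).comp (LipschitzWith.prod_fst (α := ℝ) (β := ℝ))).neg
    rwa [mul_one] at this
  exact h1.prodMk h2

/-- Uniqueness for `ẍ + g(x, t) = 0` with data at an arbitrary time. -/
theorem eq_of_hasDerivAt {g : ℝ → ℝ → ℝ} {K : ℝ≥0} (hK : ∀ t, LipschitzWith K fun x => g x t)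
    {x v y w : ℝ → ℝ} (hx : ∀ t, HasDerivAt x (v t) t) (hv : ∀ t, HasDerivAt v (-g (x t) t) t)
    (hy : ∀ t, HasDerivAt y (w t) t) (hw : ∀ t, HasDerivAt w (-g (y t) t) t) {t₀ : ℝ}
    (h : x t₀ = y t₀) (h' : v t₀ = w t₀) : x = y ∧ v = w := by
  have := ODE_solution_unique_univ (v := fun t (z : ℝ × ℝ) => (z.2, -g z.1 t)) (s := fun _ => univ)
    (K := max 1 K) (f := fun t => (x t, v t)) (g := fun t => (y t, w t)) (t₀ := t₀)
    (fun t => (lipschitzWith_firstOrder hK t).lipschitzOnWith)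
    (fun t => ⟨(hx t).prodMk (hv t), mem_univ _⟩) (fun t => ⟨(hy t).prodMk (hw t), mem_univ _⟩)
    (by simp [h, h'])
  exact ⟨funext fun t => congrArg Prod.fst (congrFun this t),
    funext fun t => congrArg Prod.snd (congrFun this t)⟩

theorem IsIVPSolution.hasDerivAt {g : ℝ → ℝ → ℝ} {a b : ℝ} {x : ℝ → ℝ} (h : IsIVPSolution g a b x)
    (t : ℝ) : HasDerivAt x (deriv x t) t :=
  (h.differentiable t).hasDerivAt

theorem isIVPSolution_of_hasDerivAt {g : ℝ → ℝ → ℝ} {x v : ℝ → ℝ}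
    (hx : ∀ t, HasDerivAt x (v t) t) (hv : ∀ t, HasDerivAt v (-g (x t) t) t) :
    IsIVPSolution g (x 0) (v 0) x := by
  have : deriv x = v := funext fun t => (hx t).deriv
  exact ⟨fun t => (hx t).differentiableAt, by rw [this]; exact hv, rfl, by rw [this]⟩

theorem IsIVPSolution.unique {g : ℝ → ℝ → ℝ} {K : ℝ≥0} (hK : ∀ t, LipschitzWith K fun x => g x t)
    {a b : ℝ} {x y : ℝ → ℝ} (hx : IsIVPSolution g a b x) (hy : IsIVPSolution g a b y) : x = y :=
  (eq_of_hasDerivAt hK hx.hasDerivAt hx.ode hy.hasDerivAt hy.ode (t₀ := 0)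
    (hx.init.trans hy.init.symm) (hx.init_deriv.trans hy.init_deriv.symm)).1

theorem isIVPSolution_ivpSolution {g : ℝ → ℝ → ℝ} (hg : Continuous (uncurry g)) {K : ℝ≥0}
    (hK : ∀ t, LipschitzWith K fun x => g x t) (h0 : ∀ t, g 0 t = 0) (a b : ℝ) :
    IsIVPSolution g a b (ivpSolution g a b) := by
  obtain ⟨z, hz0, hz⟩ := exists_forall_hasDerivAt_of_lipschitz
    (f := fun t (z : ℝ × ℝ) => (z.2, -g z.1 t)) (K := max 1 K)
    (by
      have : Continuous fun p : ℝ × (ℝ × ℝ) => uncurry g (p.2.1, p.1) :=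
        hg.comp (by fun_prop)
      have h2 : Continuous fun p : ℝ × (ℝ × ℝ) => (p.2.2, -uncurry g (p.2.1, p.1)) := by fun_prop
      exact h2)
    (lipschitzWith_firstOrder hK) (fun t => by simp [h0]) (a, b)
  have h1 : ∀ t, HasDerivAt (fun t => (z t).1) (z t).2 t := fun t => by
    exact (hasFDerivAt_fst (𝕜 := ℝ) (p := z t)).comp_hasDerivAt t (hz t)
  have h2 : ∀ t, HasDerivAt (fun t => (z t).2) (-g (z t).1 t) t := fun t => by
    exact (hasFDerivAt_snd (𝕜 := ℝ) (p := z t)).comp_hasDerivAt t (hz t)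
  have h3 := isIVPSolution_of_hasDerivAt h1 h2
  rw [hz0] at h3
  exact Classical.epsilon_spec (p := IsIVPSolution g a b) ⟨_, h3⟩

theorem lipschitzWith_mul_of_abs_le {q : ℝ → ℝ} {K : ℝ} (hK : ∀ t, |q t| ≤ K) (t : ℝ) :
    LipschitzWith K.toNNReal fun y : ℝ => q t * y := by
  refine LipschitzWith.of_dist_le_mul fun x y => ?_
  rw [Real.coe_toNNReal _ ((abs_nonneg _).trans (hK t)), Real.dist_eq, Real.dist_eq, ← mul_sub,
    abs_mul]
  gcongr
  exact hK t

end SecondOrder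

/-! ### Kepler's equation and the radius -/

section Kepler

theorem kepler_spec {t e : ℝ} (he : |e| < 1) : kepler t e - e * Real.sin (kepler t e) = t :=
  (kepler_iff he).1 rfl

theorem kepler_zero (t : ℝ) : kepler t 0 = t :=
  (kepler_iff (by simp)).2 (by simp)

theorem one_sub_mul_cos_pos {e : ℝ} (he : |e| < 1) (u : ℝ) : 0 < 1 - e * Real.cos u := by
  have hc : |e * Real.cos u| ≤ |e| := by
    rw [abs_mul]
    exact mul_le_of_le_one_right (abs_nonneg e) (Real.abs_cos_le_one u)
  linarith [le_abs_self (e * Real.cos u)]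

/-- The implicit function theorem applies since 1 - e cos u > 0; global uniqueness of the root
identifies the implicit function with `kepler`. -/
theorem contDiffAt_kepler {n : ℕ∞} (hn : n ≠ 0) {t e : ℝ} (he : |e| < 1) :
    ContDiffAt ℝ n (fun p : ℝ × ℝ => kepler p.1 p.2) (t, e) := by
  set f : (ℝ × ℝ) × ℝ → ℝ := fun w => w.2 - w.1.2 * Real.sin w.2 - w.1.1 with hf
  set u : (ℝ × ℝ) × ℝ := ((t, e), kepler t e) with hu
  have hcd : ContDiffAt ℝ n f u := by
    have : ContDiff ℝ n f := by fun_prop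
    exact this.contDiffAt
  have hn' : ((n : ℕ∞) : WithTop ℕ∞) ≠ 0 := by exact_mod_cast hn
  have hd : HasDerivAt (fun y => f ((t, e), y)) (1 - e * Real.cos (kepler t e)) (kepler t e) := by
    have := ((hasDerivAt_id (kepler t e)).sub
      ((Real.hasDerivAt_sin (kepler t e)).const_mul e)).sub_const t
    exact this
  have hne : 1 - e * Real.cos (kepler t e) ≠ 0 := (one_sub_mul_cos_pos he _).ne'
  have hinv : (fderiv ℝ f u ∘L .inr ℝ (ℝ × ℝ) ℝ).IsInvertible := by
    refine ⟨ContinuousLinearEquiv.unitsEquivAut ℝ (Units.mk0 _ hne), ?_⟩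
    have h1 := (hcd.differentiableAt hn').hasFDerivAt.comp_hasDerivAt (kepler t e)
      (((hasDerivAt_const (kepler t e) ((t, e) : ℝ × ℝ)).prodMk (hasDerivAt_id (kepler t e))))
    have h2 := h1.unique hd
    ext
    simp only [ContinuousLinearEquiv.coe_coe, ContinuousLinearMap.comp_apply,
      ContinuousLinearMap.inr_apply]
    rw [h2]
    simp
  have hfu : f u = 0 := by
    have := kepler_spec (t := t) he
    simp only [hf, hu]; linarith
  have hev : ∀ᶠ p : ℝ × ℝ in 𝓝 (t, e), |p.2| < 1 :=
    (continuous_abs.comp continuous_snd).tendsto (t, e) |>.eventually_lt_const he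
  refine (hcd.contDiffAt_implicitFunction hn' hinv).congr_of_eventuallyEq ?_
  filter_upwards [hcd.eventually_apply_implicitFunction hn' hinv, hev] with p hp hpe
  rw [hfu] at hp
  refine (kepler_iff hpe).2 ?_
  simp only [hf] at hp
  linarith

theorem contDiffAt_radius {n : ℕ∞} (hn : n ≠ 0) {t e : ℝ} (he : |e| < 1) :
    ContDiffAt ℝ n (fun p : ℝ × ℝ => radius p.1 p.2) (t, e) := by
  unfold radius
  exact contDiffAt_const.mul (contDiffAt_const.sub
    (contDiffAt_snd.mul (contDiffAt_kepler hn he).cos))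

theorem radius_pos {e : ℝ} (he : |e| < 1) (t : ℝ) : 0 < radius t e := by
  unfold radius
  have := one_sub_mul_cos_pos he (kepler t e)
  positivity

theorem le_radius (t e : ℝ) : (1 - |e|) / 2 ≤ radius t e := by
  unfold radius
  have hc : |e * Real.cos (kepler t e)| ≤ |e| := by
    rw [abs_mul]
    exact mul_le_of_le_one_right (abs_nonneg e) (Real.abs_cos_le_one _)
  linarith [le_abs_self (e * Real.cos (kepler t e))]

theorem radius_zero (t : ℝ) : radius t 0 = 1 / 2 := by simp [radius]

theorem radius_neg {e : ℝ} (he : |e| < 1) (t : ℝ) : radius (-t) e = radius t e := by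
  have : kepler (-t) e = -kepler t e :=
    (kepler_iff he).2 (by rw [Real.sin_neg]; linarith [kepler_spec (t := t) he])
  simp [radius, this]

theorem radius_add_two_pi {e : ℝ} (he : |e| < 1) (t : ℝ) :
    radius (t + 2 * Real.pi) e = radius t e := by
  have : kepler (t + 2 * Real.pi) e = kepler t e + 2 * Real.pi :=
    (kepler_iff he).2 (by rw [Real.sin_add_two_pi]; linarith [kepler_spec (t := t) he])
  simp [radius, this]

/-- The derivative of u in e enters with a factor e, so at e = 0 only cos u(t, 0) = cos t survives.
-/
theorem hasDerivAt_radius_zero (t : ℝ) :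
    HasDerivAt (fun e => radius t e) (-(1 / 2) * Real.cos t) 0 := by
  have h1 : DifferentiableAt ℝ (fun e => kepler t e) 0 := by
    have := (contDiffAt_kepler (n := 1) one_ne_zero (t := t) (e := 0) (by simp)).differentiableAt
      (by simp)
    exact this.comp (0 : ℝ) (f := fun e : ℝ => ((t, e) : ℝ × ℝ)) (by fun_prop)
  have h2 := ((hasDerivAt_const (0 : ℝ) (1 : ℝ)).sub
    ((hasDerivAt_id (0 : ℝ)).mul h1.hasDerivAt.cos)).const_mul (1 / 2 : ℝ)
  refine h2.congr_deriv ?_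
  simp [kepler_zero]

end Kepler

/-! ### The force, its derivative, and symmetries of the solutions -/

section Force

theorem F_eq {e : ℝ} (he : |e| < 1) (x t : ℝ) :
    F x t e = x * (x ^ 2 + radius t e ^ 2) ^ (-(3 / 2) : ℝ) := by
  have := radius_pos he t
  rw [F, Real.rpow_neg (by positivity), div_eq_mul_inv]

/-- The derivative of the force term in `x`. -/
noncomputable def Fx (x t e : ℝ) : ℝ :=
  (x ^ 2 + radius t e ^ 2) ^ (-(3 / 2) : ℝ) -
    3 * x ^ 2 * (x ^ 2 + radius t e ^ 2) ^ (-(5 / 2) : ℝ)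

theorem hasDerivAt_F {e : ℝ} (he : |e| < 1) (x t : ℝ) :
    HasDerivAt (fun x => F x t e) (Fx x t e) x := by
  have hr := radius_pos he t
  have hS : x ^ 2 + radius t e ^ 2 ≠ 0 := by positivity
  have h1 : HasDerivAt (fun x : ℝ => x ^ 2 + radius t e ^ 2) (2 * x) x := by
    simpa using (hasDerivAt_pow 2 x).add_const (radius t e ^ 2)
  have h2 := (hasDerivAt_id x).mul (h1.rpow_const (p := -(3 / 2)) (Or.inl hS))
  have h3 : (fun x => F x t e) =
      id * fun x : ℝ => (x ^ 2 + radius t e ^ 2) ^ (-(3 / 2) : ℝ) :=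
    funext fun x => F_eq he x t
  rw [h3]
  refine h2.congr_deriv ?_
  rw [Fx, show (-(3 / 2) - 1 : ℝ) = -(5 / 2) by norm_num]
  simp only [id]
  ring

theorem deriv_F {e : ℝ} (he : |e| < 1) (x t : ℝ) : deriv (fun x => F x t e) x = Fx x t e :=
  (hasDerivAt_F he x t).deriv

theorem contDiffAt_sq_add_radius_sq {n : ℕ∞} (hn : n ≠ 0) {w : ℝ × ℝ × ℝ} (he : |w.2.2| < 1) :
    ContDiffAt ℝ n (fun w : ℝ × ℝ × ℝ => w.1 ^ 2 + radius w.2.1 w.2.2 ^ 2) w := by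
  have h : ContDiffAt ℝ n (fun w : ℝ × ℝ × ℝ => radius w.2.1 w.2.2) w :=
    (contDiffAt_radius hn he).comp (f := fun w : ℝ × ℝ × ℝ => w.2) w contDiffAt_snd
  exact (contDiffAt_fst.pow 2).add (h.pow 2)

theorem sq_add_radius_sq_pos {e : ℝ} (he : |e| < 1) (x t : ℝ) : 0 < x ^ 2 + radius t e ^ 2 := by
  have := radius_pos he t
  positivity

theorem contDiffAt_F {n : ℕ∞} (hn : n ≠ 0) {w : ℝ × ℝ × ℝ} (he : |w.2.2| < 1) :
    ContDiffAt ℝ n (fun w : ℝ × ℝ × ℝ => F w.1 w.2.1 w.2.2) w := by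
  have hS := (sq_add_radius_sq_pos he w.1 w.2.1).ne'
  refine contDiffAt_fst.div ((contDiffAt_sq_add_radius_sq hn he).rpow_const_of_ne hS) ?_
  exact (Real.rpow_pos_of_pos (sq_add_radius_sq_pos he w.1 w.2.1) _).ne'

theorem contDiffAt_Fx {n : ℕ∞} (hn : n ≠ 0) {w : ℝ × ℝ × ℝ} (he : |w.2.2| < 1) :
    ContDiffAt ℝ n (fun w : ℝ × ℝ × ℝ => Fx w.1 w.2.1 w.2.2) w := by
  have hS := (sq_add_radius_sq_pos he w.1 w.2.1).ne'
  have h := contDiffAt_sq_add_radius_sq hn he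
  exact (h.rpow_const_of_ne hS).sub
    ((contDiffAt_const.mul (contDiffAt_fst.pow 2)).mul (h.rpow_const_of_ne hS))

/-- Since x² ≤ x² + r², the second term of `Fx` is at most three times the first. The bound is
uniform in x and t, hence yields global solutions of both the equation and its linearization. -/
theorem abs_Fx_le {e : ℝ} (he : |e| < 1) (x t : ℝ) :
    |Fx x t e| ≤ 4 * (((1 - |e|) / 2) ^ 2) ^ (-(3 / 2) : ℝ) := by
  have hS := sq_add_radius_sq_pos he x t
  have hρ : 0 < (1 - |e|) / 2 := by linarith
  have h1 : (x ^ 2 + radius t e ^ 2) ^ (-(3 / 2) : ℝ) ≤ (((1 - |e|) / 2) ^ 2) ^ (-(3 / 2) : ℝ) := by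
    refine Real.rpow_le_rpow_of_nonpos (by positivity) ?_ (by norm_num)
    have := pow_le_pow_left₀ hρ.le (le_radius t e) 2
    nlinarith [sq_nonneg x]
  have h2 : x ^ 2 * (x ^ 2 + radius t e ^ 2) ^ (-(5 / 2) : ℝ) ≤
      (x ^ 2 + radius t e ^ 2) ^ (-(3 / 2) : ℝ) := by
    have : (x ^ 2 + radius t e ^ 2) ^ (-(3 / 2) : ℝ) =
        (x ^ 2 + radius t e ^ 2) ^ (-(5 / 2) : ℝ) * (x ^ 2 + radius t e ^ 2) := by
      rw [show (-(3 / 2) : ℝ) = -(5 / 2) + 1 by norm_num, Real.rpow_add_one hS.ne']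
    rw [this, mul_comm]
    gcongr
    nlinarith [sq_nonneg (radius t e)]
  have h3 : 0 ≤ x ^ 2 * (x ^ 2 + radius t e ^ 2) ^ (-(5 / 2) : ℝ) := by positivity
  have h4 : 0 < (x ^ 2 + radius t e ^ 2) ^ (-(3 / 2) : ℝ) := by positivity
  rw [Fx, abs_le]
  constructor <;> nlinarith

theorem exists_lipschitzWith_F {e : ℝ} (he : |e| < 1) :
    ∃ K : ℝ≥0, ∀ t, LipschitzWith K fun x => F x t e := by
  refine ⟨(4 * (((1 - |e|) / 2) ^ 2) ^ (-(3 / 2) : ℝ)).toNNReal, fun t => ?_⟩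
  refine lipschitzWith_of_nnnorm_deriv_le (fun x => (hasDerivAt_F he x t).differentiableAt)
    fun x => ?_
  rw [deriv_F he, ← NNReal.coe_le_coe, coe_nnnorm, Real.norm_eq_abs,
    Real.coe_toNNReal _ ((abs_nonneg _).trans (abs_Fx_le he x t))]
  exact abs_Fx_le he x t

theorem continuous_F {e : ℝ} (he : |e| < 1) : Continuous (uncurry fun x t => F x t e) := by
  rw [continuous_iff_continuousAt]
  intro w
  have := (contDiffAt_F (n := 1) one_ne_zero (w := (w.1, w.2, e)) he).continuousAt
  exact this.comp (f := fun w : ℝ × ℝ => (w.1, w.2, e)) (by fun_prop)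

theorem continuous_Fx {e : ℝ} (he : |e| < 1) : Continuous (uncurry fun x t => Fx x t e) := by
  rw [continuous_iff_continuousAt]
  intro w
  have := (contDiffAt_Fx (n := 1) one_ne_zero (w := (w.1, w.2, e)) he).continuousAt
  exact this.comp (f := fun w : ℝ × ℝ => (w.1, w.2, e)) (by fun_prop)

theorem isIVPSolution_X {e : ℝ} (he : |e| < 1) (ξ : ℝ) :
    IsIVPSolution (fun x s => F x s e) ξ 0 fun t => X t ξ e := by
  obtain ⟨K, hK⟩ := exists_lipschitzWith_F he
  exact isIVPSolution_ivpSolution (continuous_F he) hK (fun t => by simp [F]) ξ 0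

/-- The velocity of the solution `X`. -/
noncomputable def XDot (t ξ e : ℝ) : ℝ := deriv (fun s => X s ξ e) t

theorem hasDerivAt_X {e : ℝ} (he : |e| < 1) (t ξ : ℝ) :
    HasDerivAt (fun s => X s ξ e) (XDot t ξ e) t :=
  (isIVPSolution_X he ξ).hasDerivAt t

theorem hasDerivAt_XDot {e : ℝ} (he : |e| < 1) (t ξ : ℝ) :
    HasDerivAt (fun s => XDot s ξ e) (-F (X t ξ e) t e) t :=
  (isIVPSolution_X he ξ).ode t

theorem X_init {e : ℝ} (he : |e| < 1) (ξ : ℝ) : X 0 ξ e = ξ := (isIVPSolution_X he ξ).init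

theorem XDot_init {e : ℝ} (he : |e| < 1) (ξ : ℝ) : XDot 0 ξ e = 0 :=
  (isIVPSolution_X he ξ).init_deriv

/-- Source of all symmetries of `X`: a reflected or shifted solution is again a solution, so one
matching time suffices. -/
theorem eq_X_of_hasDerivAt {e : ℝ} (he : |e| < 1) {ξ t₀ : ℝ} {y w : ℝ → ℝ}
    (hy : ∀ t, HasDerivAt y (w t) t) (hw : ∀ t, HasDerivAt w (-F (y t) t e) t)
    (h : y t₀ = X t₀ ξ e) (h' : w t₀ = XDot t₀ ξ e) (t : ℝ) :
    y t = X t ξ e ∧ w t = XDot t ξ e := by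
  obtain ⟨K, hK⟩ := exists_lipschitzWith_F he
  have := eq_of_hasDerivAt (g := fun x t => F x t e) hK hy hw (fun t => hasDerivAt_X he t ξ)
    (fun t => hasDerivAt_XDot he t ξ) h h'
  exact ⟨congrFun this.1 t, congrFun this.2 t⟩

theorem hasDerivAt_comp_neg {y : ℝ → ℝ} {d : ℝ} {t : ℝ} (h : HasDerivAt y d (-t)) :
    HasDerivAt (fun s => y (-s)) (-d) t := by
  exact (h.comp t (hasDerivAt_neg t)).congr_deriv (mul_neg_one d)

theorem X_neg {e : ℝ} (he : |e| < 1) (ξ t : ℝ) :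
    X (-t) ξ e = X t ξ e ∧ XDot (-t) ξ e = -XDot t ξ e := by
  have := eq_X_of_hasDerivAt he (ξ := ξ) (t₀ := 0) (y := fun s => X (-s) ξ e)
    (w := fun s => -XDot (-s) ξ e) (fun t => hasDerivAt_comp_neg (hasDerivAt_X he (-t) ξ))
    (fun t => by
      have := (hasDerivAt_comp_neg (hasDerivAt_XDot he (-t) ξ)).neg
      refine this.congr_deriv ?_
      simp [F, radius_neg he])
    (by simp) (by simp [XDot_init he]) t
  exact ⟨this.1, by rw [← this.2, neg_neg]⟩

theorem radius_add_nat_mul_two_pi {e : ℝ} (he : |e| < 1) (m : ℕ) (t : ℝ) :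
    radius (t + m * (2 * Real.pi)) e = radius t e := by
  have : Periodic (fun t => radius t e) (2 * Real.pi) := radius_add_two_pi he
  exact this.nat_mul m t

/-- An even solution whose velocity vanishes at `m π` is `2 m π`-periodic. -/
theorem X_add_of_XDot_eq_zero {e : ℝ} (he : |e| < 1) {ξ : ℝ} {m : ℕ}
    (h : XDot (m * Real.pi) ξ e = 0) (t : ℝ) :
    X (t + m * (2 * Real.pi)) ξ e = X t ξ e ∧ XDot (t + m * (2 * Real.pi)) ξ e = XDot t ξ e := by
  have hneg := X_neg he ξ (m * Real.pi)
  have hsum : -(m * Real.pi) + m * (2 * Real.pi) = m * Real.pi := by ring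
  refine eq_X_of_hasDerivAt he (ξ := ξ) (t₀ := -(m * Real.pi))
    (y := fun s => X (s + m * (2 * Real.pi)) ξ e) (w := fun s => XDot (s + m * (2 * Real.pi)) ξ e)
    (fun t => (hasDerivAt_X he _ ξ).comp_add_const t _)
    (fun t => by
      have := (hasDerivAt_XDot he (t + m * (2 * Real.pi)) ξ).comp_add_const t _
      refine this.congr_deriv ?_
      simp [F, radius_add_nat_mul_two_pi he])
    ?_ ?_ t
  · rw [hsum, hneg.1]
  · rw [hsum, hneg.2, h, neg_zero]

end Force

/-! ### The circular problem: quarter periods and their range -/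

section Circular

theorem F_zero (x t : ℝ) : F x t 0 = x * (x ^ 2 + 1 / 4) ^ (-(3 / 2) : ℝ) := by
  rw [F_eq (by simp), radius_zero]; norm_num

theorem Fx_zero (x t : ℝ) : Fx x t 0 = (x ^ 2 + 1 / 4) ^ (-(3 / 2) : ℝ) -
    3 * x ^ 2 * (x ^ 2 + 1 / 4) ^ (-(5 / 2) : ℝ) := by
  rw [Fx, radius_zero]; norm_num

theorem hasDerivAt_X_zero (t ξ : ℝ) : HasDerivAt (fun s => X s ξ 0) (XDot t ξ 0) t :=
  hasDerivAt_X (by simp) t ξ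

theorem hasDerivAt_XDot_zero (t ξ : ℝ) :
    HasDerivAt (fun s => XDot s ξ 0) (-F (X t ξ 0) t 0) t :=
  hasDerivAt_XDot (by simp) t ξ

theorem continuous_X_zero (ξ : ℝ) : Continuous fun t => X t ξ 0 :=
  continuous_iff_continuousAt.2 fun t => (hasDerivAt_X_zero t ξ).continuousAt

theorem continuous_XDot_zero (ξ : ℝ) : Continuous fun t => XDot t ξ 0 :=
  continuous_iff_continuousAt.2 fun t => (hasDerivAt_XDot_zero t ξ).continuousAt

theorem F_zero_pos {x : ℝ} (hx : 0 < x) (t : ℝ) : 0 < F x t 0 := by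
  rw [F_zero]; positivity

theorem F_zero_neg (x t t' : ℝ) : F (-x) t 0 = -F x t' 0 := by
  rw [F_zero, F_zero, neg_sq]; ring

/-- `s` is the first positive zero of the solution of the circular problem that starts at rest
from `ξ`. -/
structure IsQuarterPeriod (ξ s : ℝ) : Prop where
  pos : 0 < s
  eq_zero : X s ξ 0 = 0
  pos_of_mem : ∀ t ∈ Ico 0 s, 0 < X t ξ 0

theorem XDot_strictAntiOn {ξ s : ℝ} (h : ∀ t ∈ Ioo 0 s, 0 < X t ξ 0) :
    StrictAntiOn (fun t => XDot t ξ 0) (Icc 0 s) := by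
  refine strictAntiOn_of_deriv_neg (convex_Icc 0 s) (continuous_XDot_zero ξ).continuousOn ?_
  intro t ht
  rw [interior_Icc] at ht
  rw [(hasDerivAt_XDot_zero t ξ).deriv, neg_lt_zero]
  exact F_zero_pos (h t ht) t

theorem XDot_neg_of_forall_pos {ξ s : ℝ} (h : ∀ t ∈ Ioo 0 s, 0 < X t ξ 0) {t : ℝ}
    (ht : t ∈ Ioc 0 s) : XDot t ξ 0 < 0 := by
  have := XDot_strictAntiOn h ⟨le_rfl, ht.1.le.trans ht.2⟩ (Ioc_subset_Icc_self ht) ht.1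
  simpa [XDot_init (e := 0) (by simp)] using this

theorem X_strictAntiOn {ξ s : ℝ} (h : ∀ t ∈ Ioo 0 s, 0 < X t ξ 0) :
    StrictAntiOn (fun t => X t ξ 0) (Icc 0 s) := by
  refine strictAntiOn_of_deriv_neg (convex_Icc 0 s) (continuous_X_zero ξ).continuousOn ?_
  intro t ht
  rw [interior_Icc] at ht
  rw [(hasDerivAt_X_zero t ξ).deriv]
  exact XDot_neg_of_forall_pos h ⟨ht.1, ht.2.le⟩

/-- The circular force is odd and autonomous, so point reflection about (s, 0) gives a solution with
the same data at s. -/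
theorem X_two_mul_sub {ξ s : ℝ} (h : X s ξ 0 = 0) (t : ℝ) :
    X (2 * s - t) ξ 0 = -X t ξ 0 ∧ XDot (2 * s - t) ξ 0 = XDot t ξ 0 := by
  have := eq_X_of_hasDerivAt (e := 0) (by simp) (ξ := ξ) (t₀ := s)
    (y := fun t => -X (2 * s - t) ξ 0) (w := fun t => XDot (2 * s - t) ξ 0)
    (fun t => by
      refine ((hasDerivAt_X_zero (2 * s - t) ξ).comp_const_sub (2 * s) t).neg.congr_deriv ?_
      simp)
    (fun t => by
      refine ((hasDerivAt_XDot_zero (2 * s - t) ξ).comp_const_sub (2 * s) t).congr_deriv ?_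
      rw [F_zero_neg _ t (2 * s - t)])
    (by rw [show 2 * s - s = s by ring, h, neg_zero])
    (by rw [show 2 * s - s = s by ring]) t
  exact ⟨by rw [← this.1, neg_neg], this.2⟩

namespace IsQuarterPeriod

variable {ξ s : ℝ} (h : IsQuarterPeriod ξ s)
include h

theorem start_pos : 0 < ξ := by
  have := h.pos_of_mem 0 ⟨le_rfl, h.pos⟩
  rwa [X_init (by simp)] at this

theorem pos_of_mem_Ioo : ∀ t ∈ Ioo 0 s, 0 < X t ξ 0 := fun t ht =>
  h.pos_of_mem t ⟨ht.1.le, ht.2⟩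

theorem X_add_two_mul (t : ℝ) :
    X (t + 2 * s) ξ 0 = -X t ξ 0 ∧ XDot (t + 2 * s) ξ 0 = -XDot t ξ 0 := by
  have h1 := X_two_mul_sub h.eq_zero (-t)
  have h2 := X_neg (e := 0) (by simp) ξ t
  rw [sub_neg_eq_add, add_comm, h2.1, h2.2] at h1
  exact h1

theorem X_add_four_mul (t : ℝ) : X (t + 4 * s) ξ 0 = X t ξ 0 := by
  rw [show t + 4 * s = t + 2 * s + 2 * s by ring, (h.X_add_two_mul _).1, (h.X_add_two_mul _).1,
    neg_neg]

theorem X_lt_start_of_le {t : ℝ} (ht : 0 < t) (hts : t ≤ 2 * s) : X t ξ 0 < ξ := by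
  have hanti := X_strictAntiOn h.pos_of_mem_Ioo
  rcases le_total t s with h1 | h1
  · have := hanti ⟨le_rfl, h.pos.le⟩ ⟨ht.le, h1⟩ ht
    simpa [X_init (e := 0) (by simp)] using this
  · have h2 := (X_two_mul_sub h.eq_zero t).1
    have h3 : X s ξ 0 ≤ X (2 * s - t) ξ 0 :=
      hanti.antitoneOn ⟨by linarith, by linarith⟩ ⟨h.pos.le, le_rfl⟩ (by linarith)
    rw [h.eq_zero] at h3
    linarith [h.start_pos]

theorem X_lt_start {t : ℝ} (ht : 0 < t) (hts : t < 4 * s) : X t ξ 0 < ξ := by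
  rcases le_total t (2 * s) with h1 | h1
  · exact h.X_lt_start_of_le ht h1
  · have h2 := h.X_add_four_mul (-t)
    rw [(X_neg (e := 0) (by simp) ξ t).1] at h2
    rw [← h2]
    exact h.X_lt_start_of_le (by linarith) (by linarith)

/-- A smaller period would bring the solution back to ξ, yet it stays below ξ strictly inside (0,
4s). -/
theorem hasMinimalPeriod : HasMinimalPeriod (fun t => X t ξ 0) (4 * s) := by
  refine ⟨⟨by linarith [h.pos], h.X_add_four_mul⟩, fun S hS => ?_⟩
  by_contra! hlt
  have h1 := h.X_lt_start hS.1 hlt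
  have h2 := hS.2 0
  simp only [zero_add, X_init (e := 0) (by simp)] at h2
  linarith

theorem X_nat_mul (n : ℕ) : X (n * (2 * s)) ξ 0 = (-1) ^ n * ξ ∧ XDot (n * (2 * s)) ξ 0 = 0 := by
  induction n with
  | zero => simp [X_init (e := 0) (by simp), XDot_init (e := 0) (by simp)]
  | succ k ih =>
    have := h.X_add_two_mul (k * (2 * s))
    rw [ih.1, ih.2] at this
    push_cast
    rw [add_mul, one_mul, this.1, this.2, pow_succ]
    constructor <;> ring

theorem XDot_neg : XDot s ξ 0 < 0 :=
  XDot_neg_of_forall_pos h.pos_of_mem_Ioo ⟨h.pos, le_rfl⟩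

end IsQuarterPeriod

/-- The minimal period is four times the first zero. -/
theorem isQuarterPeriod_of_hasMinimalPeriod {ξ T : ℝ} (hξ : 0 < ξ)
    (hT : HasMinimalPeriod (fun t => X t ξ 0) T) : IsQuarterPeriod ξ (T / 4) := by
  obtain ⟨⟨hT0, hper⟩, -⟩ := id hT
  -- If x stayed positive, the velocity would decrease strictly from 0 and could not return to 0 at
  -- the period.
  have hex : ∃ t ∈ Icc 0 T, X t ξ 0 ≤ 0 := by
    by_contra! hcon
    have h1 := XDot_neg_of_forall_pos (s := T) (fun t ht => hcon t (Ioo_subset_Icc_self ht))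
      ⟨hT0, le_rfl⟩
    have h2 : XDot T ξ 0 = XDot 0 ξ 0 := by
      have h3 := (hasDerivAt_X_zero (0 + T) ξ).comp_add_const 0 T
      have h4 : (fun t => X (t + T) ξ 0) = fun t => X t ξ 0 := funext hper
      rw [h4] at h3
      simpa using h3.unique (hasDerivAt_X_zero 0 ξ)
    rw [h2, XDot_init (by simp)] at h1
    exact lt_irrefl _ h1
  obtain ⟨t, ht, htX⟩ := hex
  have hcomp : IsCompact {t ∈ Icc 0 T | X t ξ 0 ≤ 0} :=
    isCompact_Icc.inter_right (isClosed_le (continuous_X_zero ξ) continuous_const)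
  obtain ⟨s, ⟨hs, hsX⟩, hleast⟩ := hcomp.exists_isLeast ⟨t, ht, htX⟩
  have hpos : ∀ t ∈ Ico 0 s, 0 < X t ξ 0 := fun t ht => by
    by_contra! hcon
    exact absurd (hleast ⟨⟨ht.1, ht.2.le.trans hs.2⟩, hcon⟩) (not_le.2 ht.2)
  have hs0 : 0 < s := by
    refine lt_of_le_of_ne hs.1 fun h0 => ?_
    rw [← h0, X_init (by simp)] at hsX
    linarith
  have hsX' : X s ξ 0 = 0 := by
    refine le_antisymm hsX ?_
    refine ge_of_tendsto (x := 𝓝[<] s)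
      ((continuous_X_zero ξ).continuousAt.tendsto.mono_left nhdsWithin_le_nhds) ?_
    filter_upwards [Ioo_mem_nhdsLT hs0] with t ht
    exact (hpos t ⟨ht.1.le, ht.2⟩).le
  have hq : IsQuarterPeriod ξ s := ⟨hs0, hsX', hpos⟩
  have : T = 4 * s := hT.unique hq.hasMinimalPeriod
  rw [this, mul_div_cancel_left₀ _ (by norm_num)]
  exact hq

theorem exists_dist_X_le (s : ℝ) :
    ∃ C > 0, ∀ t ∈ Icc 0 s, ∀ ξ ξ' : ℝ, |X t ξ 0 - X t ξ' 0| ≤ C * |ξ - ξ'| := by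
  obtain ⟨K, hK⟩ := exists_lipschitzWith_F (e := 0) (by simp)
  refine ⟨Real.exp ((max 1 K : ℝ≥0) * s), Real.exp_pos _, fun t ht ξ ξ' => ?_⟩
  have := dist_le_of_trajectories_ODE (a := 0) (b := s) (K := max 1 K)
    (v := fun t (z : ℝ × ℝ) => (z.2, -F z.1 t 0))
    (f := fun t => (X t ξ 0, XDot t ξ 0)) (g := fun t => (X t ξ' 0, XDot t ξ' 0))
    (δ := |ξ - ξ'|)
    (fun t => lipschitzWith_firstOrder (g := fun x t => F x t 0) hK t)
    ((continuous_X_zero ξ).prodMk (continuous_XDot_zero ξ)).continuousOn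
    (fun t _ => ((hasDerivAt_X_zero t ξ).prodMk (hasDerivAt_XDot_zero t ξ)).hasDerivWithinAt)
    ((continuous_X_zero ξ').prodMk (continuous_XDot_zero ξ')).continuousOn
    (fun t _ => ((hasDerivAt_X_zero t ξ').prodMk (hasDerivAt_XDot_zero t ξ')).hasDerivWithinAt)
    (by simp [Prod.dist_eq, X_init (e := 0) (by simp), XDot_init (e := 0) (by simp), Real.dist_eq])
    t ht
  rw [Prod.dist_eq, Real.dist_eq, sub_zero] at this
  refine (le_max_left _ _).trans (this.trans ?_)
  rw [mul_comm]
  gcongr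
  exact ht.2

/-- The force never exceeds 4. Hence large amplitudes cannot reach zero within a given time. -/
theorem X_lower_bound (ξ : ℝ) {t : ℝ} (ht : 0 ≤ t) : ξ - 2 * t ^ 2 ≤ X t ξ 0 := by
  have hF : ∀ x t, F x t 0 ≤ 4 := fun x t => by
    have hS : 0 < x ^ 2 + 1 / 4 := by positivity
    have h1 : |x| ≤ (x ^ 2 + 1 / 4) ^ (1 / 2 : ℝ) := by
      rw [← Real.sqrt_eq_rpow]
      exact Real.abs_le_sqrt (by linarith)
    rw [F_zero]
    calc x * (x ^ 2 + 1 / 4) ^ (-(3 / 2) : ℝ)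
        ≤ (x ^ 2 + 1 / 4) ^ (1 / 2 : ℝ) * (x ^ 2 + 1 / 4) ^ (-(3 / 2) : ℝ) := by
          gcongr; exact (le_abs_self x).trans h1
      _ = (x ^ 2 + 1 / 4)⁻¹ := by
          rw [← Real.rpow_add hS, ← Real.rpow_neg_one]; norm_num
      _ ≤ (1 / 4 : ℝ)⁻¹ := by gcongr; linarith [sq_nonneg x]
      _ = 4 := by norm_num
  have h1 : MonotoneOn (fun t => XDot t ξ 0 + 4 * t) (Ici 0) := by
    refine monotoneOn_of_hasDerivWithinAt_nonneg (convex_Ici 0)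
      (f' := fun t => -F (X t ξ 0) t 0 + 4)
      ((continuous_XDot_zero ξ).add (by fun_prop)).continuousOn (fun t _ => ?_) fun t _ => ?_
    · have := (hasDerivAt_XDot_zero t ξ).add ((hasDerivAt_id t).const_mul 4)
      rw [mul_one] at this
      exact this.hasDerivWithinAt
    · linarith [hF (X t ξ 0) t]
  have h2 : MonotoneOn (fun t => X t ξ 0 + 2 * t ^ 2) (Ici 0) := by
    refine monotoneOn_of_hasDerivWithinAt_nonneg (convex_Ici 0)
      (f' := fun t => XDot t ξ 0 + 4 * t)
      ((continuous_X_zero ξ).add (by fun_prop)).continuousOn (fun t _ => ?_) fun t ht' => ?_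
    · have := (hasDerivAt_X_zero t ξ).add ((hasDerivAt_pow 2 t).const_mul 2)
      refine HasDerivAt.hasDerivWithinAt (this.congr_deriv ?_)
      push_cast; ring
    · rw [interior_Ici] at ht'
      have := h1 (mem_Ici.2 le_rfl) (mem_Ici.2 ht'.le) ht'.le
      simpa [XDot_init (e := 0) (by simp)] using this
  have := h2 (mem_Ici.2 le_rfl) (mem_Ici.2 ht) ht
  simp only [X_init (e := 0) (by simp)] at this
  linarith

/-- Small oscillations have frequency close to `√8`. -/
theorem exists_X_nonpos {s : ℝ} (hs : 0 < s) (h8 : (Real.pi / (2 * s)) ^ 2 < 8) :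
    ∃ ξ > 0, ∃ t ∈ Icc 0 s, X t ξ 0 ≤ 0 := by
  set ω := Real.pi / (2 * s) with hω
  have hω0 : 0 < ω := by positivity
  have hωs : ω * s = Real.pi / 2 := by rw [hω]; field_simp
  have h80 : ((0 : ℝ) ^ 2 + 1 / 4) ^ (-(3 / 2) : ℝ) = 8 := by
    rw [show ((0 : ℝ) ^ 2 + 1 / 4) = (2 : ℝ) ^ (-2 : ℝ) by
      rw [Real.rpow_neg (by norm_num)]; norm_num, ← Real.rpow_mul (by norm_num)]
    norm_num
  have hlim : Tendsto (fun ξ : ℝ => (ξ ^ 2 + 1 / 4) ^ (-(3 / 2) : ℝ)) (𝓝[>] 0) (𝓝 8) := by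
    have : ContinuousAt (fun ξ : ℝ => (ξ ^ 2 + 1 / 4) ^ (-(3 / 2) : ℝ)) 0 :=
      ContinuousAt.rpow_const (by fun_prop) (Or.inl (by norm_num))
    have h := this.tendsto
    rw [h80] at h
    exact h.mono_left nhdsWithin_le_nhds
  -- For this ξ, F(x)/x > ω² whenever 0 < x ≤ ξ.
  obtain ⟨ξ, hξω, hξ⟩ := ((hlim.eventually_const_lt h8).and self_mem_nhdsWithin).exists
  have hξ0 : 0 < ξ := hξ
  refine ⟨ξ, hξ0, ?_⟩
  by_contra! hcon
  have hpos : ∀ t ∈ Ioo 0 s, 0 < X t ξ 0 := fun t ht => hcon t (Ioo_subset_Icc_self ht)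
  have hle : ∀ t ∈ Icc 0 s, X t ξ 0 ≤ ξ := fun t ht => by
    have := (X_strictAntiOn hpos).antitoneOn ⟨le_rfl, hs.le⟩ ht ht.1
    simpa [X_init (e := 0) (by simp)] using this
  have hsin : ∀ t, HasDerivAt (fun t => Real.sin (ω * t)) (Real.cos (ω * t) * ω) t := fun t =>
    (((hasDerivAt_id t).const_mul ω).sin).congr_deriv (by simp)
  have hcos : ∀ t, HasDerivAt (fun t => Real.cos (ω * t)) (-Real.sin (ω * t) * ω) t := fun t =>
    (((hasDerivAt_id t).const_mul ω).cos).congr_deriv (by simp)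
  -- The Wronskian of x with cos(ωt), which first vanishes at s. It starts at 0 and ends at -ωx(s),
  -- so monotonicity contradicts x(s) > 0.
  have hmono : MonotoneOn
      (fun t => X t ξ 0 * (-ω * Real.sin (ω * t)) - XDot t ξ 0 * Real.cos (ω * t)) (Icc 0 s) := by
    have hd := fun t => ((hasDerivAt_X_zero t ξ).mul ((hsin t).const_mul (-ω))).sub
      ((hasDerivAt_XDot_zero t ξ).mul (hcos t))
    refine monotoneOn_of_hasDerivWithinAt_nonneg (convex_Icc 0 s)
      (continuous_iff_continuousAt.2 fun t => (hd t).continuousAt).continuousOn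
      (fun t _ => (hd t).hasDerivWithinAt) fun t ht => ?_
    rw [interior_Icc] at ht
    have htI := Ioo_subset_Icc_self ht
    rw [F_zero]
    have hc : 0 ≤ Real.cos (ω * t) := by
      refine Real.cos_nonneg_of_neg_pi_div_two_le_of_le ?_ ?_
      · have : 0 ≤ ω * t := mul_nonneg hω0.le ht.1.le
        linarith [Real.pi_pos]
      · rw [← hωs]; gcongr; exact ht.2.le
    have hx := hcon t htI
    have hQ : ω ^ 2 ≤ (X t ξ 0 ^ 2 + 1 / 4) ^ (-(3 / 2) : ℝ) := by
      refine hξω.le.trans (Real.rpow_le_rpow_of_nonpos (by positivity) ?_ (by norm_num))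
      gcongr
      exact hle t htI
    have : 0 ≤ ((X t ξ 0 ^ 2 + 1 / 4) ^ (-(3 / 2) : ℝ) - ω ^ 2) *
        (X t ξ 0 * Real.cos (ω * t)) :=
      mul_nonneg (by linarith) (mul_nonneg hx.le hc)
    linarith
  have h1 := hmono ⟨le_rfl, hs.le⟩ ⟨hs.le, le_rfl⟩ hs.le
  simp only [mul_zero, Real.sin_zero, Real.cos_zero, XDot_init (e := 0) (by simp), hωs,
    Real.sin_pi_div_two, Real.cos_pi_div_two] at h1
  have h2 := hcon s ⟨hs.le, le_rfl⟩
  nlinarith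

/-- Take the supremum of the amplitudes that reach a nonpositive value by time s. By continuity in ξ
its solution is nonnegative on [0, s] and touches zero, and this can happen only at s. -/
theorem exists_isQuarterPeriod {s : ℝ} (hs : 0 < s) (h8 : (Real.pi / (2 * s)) ^ 2 < 8) :
    ∃ ξ, IsQuarterPeriod ξ s := by
  set A : Set ℝ := {ξ | 0 < ξ ∧ ∃ t ∈ Icc 0 s, X t ξ 0 ≤ 0} with hA
  obtain ⟨ξ₁, hξ₁, hξ₁'⟩ := exists_X_nonpos hs h8
  have hne : A.Nonempty := ⟨ξ₁, hξ₁, hξ₁'⟩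
  have hbdd : BddAbove A := by
    refine ⟨2 * s ^ 2, fun ξ hξ => ?_⟩
    obtain ⟨-, t, ht, htX⟩ := hξ
    have := X_lower_bound ξ ht.1
    have h2 : t ^ 2 ≤ s ^ 2 := pow_le_pow_left₀ ht.1 ht.2 2
    linarith
  obtain ⟨C, hC, hCX⟩ := exists_dist_X_le s
  set ξ := sSup A with hξ
  have hξ0 : 0 < ξ := hξ₁.trans_le (le_csSup hbdd ⟨hξ₁, hξ₁'⟩)
  have hnonneg : ∀ t ∈ Icc 0 s, 0 ≤ X t ξ 0 := by
    intro t ht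
    by_contra! hcon
    set η := ξ + -X t ξ 0 / (2 * C) with hη
    have hpos : 0 < -X t ξ 0 / (2 * C) := div_pos (by linarith) (by positivity)
    have h1 := hCX t ht η ξ
    rw [show η - ξ = -X t ξ 0 / (2 * C) by rw [hη]; ring, abs_of_pos hpos] at h1
    have h2 : C * (-X t ξ 0 / (2 * C)) = -X t ξ 0 / 2 := by field_simp
    have h3 := (le_abs_self _).trans h1
    have h4 : η ∈ A := ⟨by linarith, t, ht, by linarith⟩
    linarith [le_csSup hbdd h4]
  have hzero : ∃ t ∈ Icc 0 s, X t ξ 0 = 0 := by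
    obtain ⟨t₀, ht₀, hmin⟩ := isCompact_Icc.exists_isMinOn (nonempty_Icc.2 hs.le)
      (continuous_X_zero ξ).continuousOn
    refine ⟨t₀, ht₀, le_antisymm ?_ (hnonneg t₀ ht₀)⟩
    by_contra! hcon
    obtain ⟨η, hη, hηξ⟩ := exists_lt_of_lt_csSup hne
      (show ξ - X t₀ ξ 0 / C < sSup A by rw [← hξ]; linarith [div_pos hcon hC])
    obtain ⟨-, t, ht, htX⟩ := id hη
    have h1 := hCX t ht ξ η
    rw [abs_of_nonneg (sub_nonneg.2 (le_csSup hbdd hη))] at h1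
    have h2 : C * (ξ - η) < X t₀ ξ 0 := by
      rw [mul_comm, ← lt_div_iff₀ hC]; linarith
    have h3 : X t₀ ξ 0 ≤ X t ξ 0 := hmin ht
    linarith [le_abs_self (X t ξ 0 - X t η 0)]
  -- A zero before s would be a local minimum, so position and velocity vanish together and the
  -- solution is trivial.
  have hne_zero : ∀ t ∈ Ico 0 s, X t ξ 0 ≠ 0 := by
    intro t ht h0
    have ht0 : 0 < t := by
      refine lt_of_le_of_ne ht.1 fun h => ?_
      rw [← h, X_init (by simp)] at h0
      linarith
    have hmin : IsLocalMin (fun t => X t ξ 0) t := by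
      filter_upwards [Icc_mem_nhds ht0 ht.2] with r hr
      rw [h0]
      exact hnonneg r hr
    have hv : XDot t ξ 0 = 0 := hmin.hasDerivAt_eq_zero (hasDerivAt_X_zero t ξ)
    have := eq_X_of_hasDerivAt (e := 0) (by simp) (ξ := ξ) (t₀ := t) (y := fun _ => 0)
      (w := fun _ => 0) (fun t => hasDerivAt_const t 0)
      (fun t => by simpa [F] using hasDerivAt_const t (0 : ℝ)) h0.symm hv.symm 0
    rw [X_init (by simp)] at this
    linarith [this.1]
  refine ⟨ξ, hs, ?_, fun t ht =>
    lt_of_le_of_ne (hnonneg t (Ico_subset_Icc_self ht)) (hne_zero t ht).symm⟩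
  obtain ⟨t, ht, htX⟩ := hzero
  rcases eq_or_lt_of_le ht.2 with h | h
  · rwa [← h]
  · exact absurd htX (hne_zero t ⟨ht.1, h⟩)

end Circular

/-! ### The linearized equation along a solution -/

section Hill

/-- The coefficient of the linearization along `X(·, ξ, e)`. -/
noncomputable def hillCoeff (ξ e t : ℝ) : ℝ := Fx (X t ξ e) t e

/-- The solution of the linearization along `X(·, ξ, e)` with initial data `(a, b)`. -/
noncomputable def hillSol (a b ξ e : ℝ) : ℝ → ℝ :=
  ivpSolution (fun y t => hillCoeff ξ e t * y) a b

/-- The velocity of `hillSol`. -/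
noncomputable def hillVel (a b ξ e : ℝ) : ℝ → ℝ := deriv (hillSol a b ξ e)

variable {e : ℝ} (he : |e| < 1)
include he

theorem continuous_X (ξ : ℝ) : Continuous fun t => X t ξ e :=
  continuous_iff_continuousAt.2 fun t => (hasDerivAt_X he t ξ).continuousAt

theorem continuous_hillCoeff (ξ : ℝ) : Continuous (hillCoeff ξ e) :=
  (continuous_Fx he).comp ((continuous_X he ξ).prodMk continuous_id)

theorem abs_hillCoeff_le (ξ t : ℝ) :
    |hillCoeff ξ e t| ≤ 4 * (((1 - |e|) / 2) ^ 2) ^ (-(3 / 2) : ℝ) := abs_Fx_le he _ _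

theorem isIVPSolution_hillSol (a b ξ : ℝ) :
    IsIVPSolution (fun y t => hillCoeff ξ e t * y) a b (hillSol a b ξ e) := by
  refine isIVPSolution_ivpSolution ?_ (lipschitzWith_mul_of_abs_le (abs_hillCoeff_le he ξ))
    (fun t => mul_zero _) a b
  exact ((continuous_hillCoeff he ξ).comp continuous_snd).mul continuous_fst

theorem hasDerivAt_hillSol (a b ξ t : ℝ) :
    HasDerivAt (hillSol a b ξ e) (hillVel a b ξ e t) t :=
  (isIVPSolution_hillSol he a b ξ).hasDerivAt t

theorem hasDerivAt_hillVel (a b ξ t : ℝ) :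
    HasDerivAt (hillVel a b ξ e) (-(hillCoeff ξ e t * hillSol a b ξ e t)) t :=
  (isIVPSolution_hillSol he a b ξ).ode t

theorem hillSol_init (a b ξ : ℝ) : hillSol a b ξ e 0 = a := (isIVPSolution_hillSol he a b ξ).init

theorem hillVel_init (a b ξ : ℝ) : hillVel a b ξ e 0 = b :=
  (isIVPSolution_hillSol he a b ξ).init_deriv

theorem hill_unique {ξ t₀ : ℝ} {y w z v : ℝ → ℝ}
    (hy : ∀ t, HasDerivAt y (w t) t) (hw : ∀ t, HasDerivAt w (-(hillCoeff ξ e t * y t)) t)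
    (hz : ∀ t, HasDerivAt z (v t) t) (hv : ∀ t, HasDerivAt v (-(hillCoeff ξ e t * z t)) t)
    (h : y t₀ = z t₀) (h' : w t₀ = v t₀) (t : ℝ) : y t = z t ∧ w t = v t := by
  have := eq_of_hasDerivAt (lipschitzWith_mul_of_abs_le (abs_hillCoeff_le he ξ)) hy hw hz hv h h'
  exact ⟨congrFun this.1 t, congrFun this.2 t⟩

/-- Variations in the parameters are constructed on a compact time interval only, hence this local
form. -/
theorem hill_unique_Icc {ξ T : ℝ} {y w z v : ℝ → ℝ}
    (hy : ∀ t ∈ Icc 0 T, HasDerivAt y (w t) t)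
    (hw : ∀ t ∈ Icc 0 T, HasDerivAt w (-(hillCoeff ξ e t * y t)) t)
    (hz : ∀ t ∈ Icc 0 T, HasDerivAt z (v t) t)
    (hv : ∀ t ∈ Icc 0 T, HasDerivAt v (-(hillCoeff ξ e t * z t)) t)
    (h : y 0 = z 0) (h' : w 0 = v 0) {t : ℝ} (ht : t ∈ Icc 0 T) : y t = z t ∧ w t = v t := by
  have := ODE_solution_unique_of_mem_Icc_right (a := 0) (b := T) (s := fun _ => univ)
    (v := fun t (z : ℝ × ℝ) => (z.2, -(hillCoeff ξ e t * z.1)))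
    (f := fun t => (y t, w t)) (g := fun t => (z t, v t))
    (fun t _ => (lipschitzWith_firstOrder (g := fun y t => hillCoeff ξ e t * y)
      (lipschitzWith_mul_of_abs_le (abs_hillCoeff_le he ξ)) t).lipschitzOnWith)
    (fun t ht => ((hy t ht).prodMk (hw t ht)).continuousAt.continuousWithinAt)
    (fun t ht => ((hy t (Ico_subset_Icc_self ht)).prodMk
      (hw t (Ico_subset_Icc_self ht))).hasDerivWithinAt)
    (fun _ _ => mem_univ _)
    (fun t ht => ((hz t ht).prodMk (hv t ht)).continuousAt.continuousWithinAt)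
    (fun t ht => ((hz t (Ico_subset_Icc_self ht)).prodMk
      (hv t (Ico_subset_Icc_self ht))).hasDerivWithinAt)
    (fun _ _ => mem_univ _) (by simp [h, h']) ht
  exact ⟨congrArg Prod.fst this, congrArg Prod.snd this⟩

theorem trace_eq (m : ℕ) (Ξ : ℝ → ℝ) : trace m Ξ e =
    hillSol 1 0 (Ξ e) e (2 * m * Real.pi) + hillVel 0 1 (Ξ e) e (2 * m * Real.pi) := by
  have : (fun t => deriv (fun x => F x t e) (X t (Ξ e) e)) = hillCoeff (Ξ e) e :=
    funext fun t => deriv_F he _ _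
  rw [trace, this]
  rfl

end Hill

/-! ### Linearization of the circular problem and nondegeneracy -/

section CircularHill

theorem hillCoeff_zero (ξ t : ℝ) : hillCoeff ξ 0 t = (X t ξ 0 ^ 2 + 1 / 4) ^ (-(3 / 2) : ℝ) -
    3 * X t ξ 0 ^ 2 * (X t ξ 0 ^ 2 + 1 / 4) ^ (-(5 / 2) : ℝ) := Fx_zero _ _

/-- The velocity of a circular solution solves the linearized equation. -/
theorem hasDerivAt_neg_F_X_zero (ξ t : ℝ) :
    HasDerivAt (fun t => -F (X t ξ 0) t 0) (-(hillCoeff ξ 0 t * XDot t ξ 0)) t := by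
  have h1 := (hasDerivAt_F (e := 0) (by simp) (X t ξ 0) t).comp t (hasDerivAt_X_zero t ξ)
  have h2 : (fun t => -F (X t ξ 0) t 0) = fun r => -((fun x => F x t 0) ∘ fun s => X s ξ 0) r := by
    funext r
    simp [F_zero]
  rw [h2]
  exact h1.neg

theorem nonpos_of_hasDerivAt_of_forall_lt {y : ℝ → ℝ} {w a b : ℝ} (hab : a < b)
    (h : HasDerivAt y w b) (hy : ∀ t ∈ Ico a b, y b ≤ y t) : w ≤ 0 := by
  have h1 := (hasDerivWithinAt_iff_tendsto_slope' (s := Iio b) (by simp)).1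
    (h.hasDerivWithinAt (s := Iio b))
  refine le_of_tendsto h1 ?_
  filter_upwards [Ico_mem_nhdsLT hab] with t ht
  rw [slope_def_field]
  exact div_nonpos_of_nonneg_of_nonpos (by linarith [hy t ht]) (by linarith [ht.2])

theorem hillSol_one_zero_neg (ξ t : ℝ) :
    hillSol 1 0 ξ 0 (-t) = hillSol 1 0 ξ 0 t ∧ hillVel 1 0 ξ 0 (-t) = -hillVel 1 0 ξ 0 t := by
  have he : |(0 : ℝ)| < 1 := by simp
  have := hill_unique he (ξ := ξ) (t₀ := 0) (y := fun s => hillSol 1 0 ξ 0 (-s))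
    (w := fun s => -hillVel 1 0 ξ 0 (-s))
    (fun t => hasDerivAt_comp_neg (hasDerivAt_hillSol he 1 0 ξ (-t)))
    (fun t => by
      refine (hasDerivAt_comp_neg (hasDerivAt_hillVel he 1 0 ξ (-t))).neg.congr_deriv ?_
      rw [hillCoeff_zero, hillCoeff_zero, (X_neg he ξ t).1, neg_neg])
    (hasDerivAt_hillSol he 1 0 ξ) (hasDerivAt_hillVel he 1 0 ξ)
    (by simp) (by simp [hillVel_init he]) t
  exact ⟨this.1, by rw [← this.2, neg_neg]⟩

namespace IsQuarterPeriod

variable {ξ s : ℝ} (h : IsQuarterPeriod ξ s)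
include h

theorem hillCoeff_add_two_mul (t : ℝ) : hillCoeff ξ 0 (t + 2 * s) = hillCoeff ξ 0 t := by
  rw [hillCoeff_zero, hillCoeff_zero, (h.X_add_two_mul t).1, neg_sq]

/-- Sturm comparison of the equation with its linearization on `[0, b]`. -/
theorem wronskian_pos {b : ℝ} (hb : 0 < b) (hbs : b ≤ s)
    (hy : ∀ t ∈ Ioo 0 b, 0 < hillSol 1 0 ξ 0 t) :
    0 < X b ξ 0 * hillVel 1 0 ξ 0 b - XDot b ξ 0 * hillSol 1 0 ξ 0 b := by
  have he : |(0 : ℝ)| < 1 := by simp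
  have hd := fun t => ((hasDerivAt_X_zero t ξ).mul (hasDerivAt_hillVel he 1 0 ξ t)).sub
    ((hasDerivAt_XDot_zero t ξ).mul (hasDerivAt_hillSol he 1 0 ξ t))
  -- The derivative is (F(x)/x - q) x ψ₁, and F(x)/x - q = 3x²(x² + 1/4)^(-5/2) > 0.
  have hmono : StrictMonoOn (fun t => X t ξ 0 * hillVel 1 0 ξ 0 t - XDot t ξ 0 * hillSol 1 0 ξ 0 t)
      (Icc 0 b) := by
    refine strictMonoOn_of_deriv_pos (convex_Icc 0 b)
      (continuous_iff_continuousAt.2 fun t => (hd t).continuousAt).continuousOn fun t ht => ?_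
    rw [interior_Icc] at ht
    have := (hd t).deriv
    simp only [Pi.mul_def, Pi.sub_def] at this
    rw [this]
    have hx := h.pos_of_mem t ⟨ht.1.le, ht.2.trans_le hbs⟩
    have hyt := hy t ht
    rw [hillCoeff_zero, F_zero]
    have h1 : 0 < 3 * X t ξ 0 ^ 2 * (X t ξ 0 ^ 2 + 1 / 4) ^ (-(5 / 2) : ℝ) *
        (X t ξ 0 * hillSol 1 0 ξ 0 t) := by positivity
    linarith
  have := hmono ⟨le_rfl, hb.le⟩ ⟨hb.le, le_rfl⟩ hb
  simpa [hillVel_init he, XDot_init he] using this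

/-- A first zero of ψ₁ before s would have ψ̇₁ ≤ 0 and make the Wronskian nonpositive. At s itself x
= 0, so positivity of -ẋ(s)ψ₁(s) decides. -/
theorem hillSol_pos : 0 < hillSol 1 0 ξ 0 s := by
  have he : |(0 : ℝ)| < 1 := by simp
  have hcont : Continuous (hillSol 1 0 ξ 0) :=
    continuous_iff_continuousAt.2 fun t => (hasDerivAt_hillSol he 1 0 ξ t).continuousAt
  have hpos : ∀ t ∈ Ico 0 s, 0 < hillSol 1 0 ξ 0 t := by
    by_contra! hcon
    obtain ⟨t, ht, hyt⟩ := hcon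
    have hcomp : IsCompact {t ∈ Icc 0 s | hillSol 1 0 ξ 0 t ≤ 0} :=
      isCompact_Icc.inter_right (isClosed_le hcont continuous_const)
    obtain ⟨b, ⟨hb, hyb⟩, hleast⟩ := hcomp.exists_isLeast ⟨t, Ico_subset_Icc_self ht, hyt⟩
    have hbs : b < s := (hleast ⟨Ico_subset_Icc_self ht, hyt⟩).trans_lt ht.2
    have hlt : ∀ t ∈ Ico 0 b, 0 < hillSol 1 0 ξ 0 t := fun t ht => by
      by_contra! hcon
      exact absurd (hleast ⟨⟨ht.1, ht.2.le.trans hb.2⟩, hcon⟩) (not_le.2 ht.2)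
    have hb0 : 0 < b := by
      refine lt_of_le_of_ne hb.1 fun h0 => ?_
      rw [← h0, hillSol_init he] at hyb
      linarith
    have h1 := h.wronskian_pos hb0 hb.2 fun t ht => hlt t (Ioo_subset_Ico_self ht)
    have h2 : hillVel 1 0 ξ 0 b ≤ 0 := nonpos_of_hasDerivAt_of_forall_lt hb0
      (hasDerivAt_hillSol he 1 0 ξ b) fun t ht => hyb.trans (hlt t ht).le
    have h3 : XDot b ξ 0 < 0 := XDot_neg_of_forall_pos h.pos_of_mem_Ioo ⟨hb0, hb.2⟩
    have h4 := h.pos_of_mem b ⟨hb.1, hbs⟩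
    nlinarith [mul_nonneg_of_nonpos_of_nonpos h3.le hyb, mul_nonpos_of_nonneg_of_nonpos h4.le h2]
  have h1 := h.wronskian_pos h.pos le_rfl fun t ht => hpos t (Ioo_subset_Ico_self ht)
  rw [h.eq_zero] at h1
  nlinarith [h.XDot_neg]

/-- Since q has period 2s, ψ₁(t + 2s) solves the same equation. Comparing data at -s gives ψ₁(t +
2s) = -ψ₁(t) - κẋ(t) with κ = 2ψ₁(s)/ẋ(s); this is its derivative. -/
theorem hillVel_add_two_mul (t : ℝ) : hillVel 1 0 ξ 0 (t + 2 * s) =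
    -hillVel 1 0 ξ 0 t + 2 * hillSol 1 0 ξ 0 s / XDot s ξ 0 * F (X t ξ 0) t 0 := by
  have he : |(0 : ℝ)| < 1 := by simp
  set κ := 2 * hillSol 1 0 ξ 0 s / XDot s ξ 0 with hκ
  have hv := h.XDot_neg
  have := hill_unique he (ξ := ξ) (t₀ := -s) (y := fun t => hillSol 1 0 ξ 0 (t + 2 * s))
    (w := fun t => hillVel 1 0 ξ 0 (t + 2 * s))
    (z := fun t => -hillSol 1 0 ξ 0 t - κ * XDot t ξ 0)
    (v := fun t => -hillVel 1 0 ξ 0 t - κ * -F (X t ξ 0) t 0)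
    (fun t => (hasDerivAt_hillSol he 1 0 ξ (t + 2 * s)).comp_add_const t _)
    (fun t => by
      refine ((hasDerivAt_hillVel he 1 0 ξ (t + 2 * s)).comp_add_const t _).congr_deriv ?_
      rw [h.hillCoeff_add_two_mul])
    (fun t => (hasDerivAt_hillSol he 1 0 ξ t).neg.sub ((hasDerivAt_XDot_zero t ξ).const_mul κ))
    (fun t => by
      refine ((hasDerivAt_hillVel he 1 0 ξ t).neg.sub
        ((hasDerivAt_neg_F_X_zero ξ t).const_mul κ)).congr_deriv ?_
      ring)
    (by
      rw [show -s + 2 * s = s by ring, (hillSol_one_zero_neg ξ s).1, (X_neg he ξ s).2]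
      linarith [div_mul_cancel₀ (2 * hillSol 1 0 ξ 0 s) hv.ne])
    (by
      rw [show -s + 2 * s = s by ring, (hillSol_one_zero_neg ξ s).2, (X_neg he ξ s).1, h.eq_zero]
      simp [F]) t
  rw [this.2]; ring

/-- After removing the sign (-1)ⁿ every shift by 2s adds the same quantity, so contributions
accumulate and never cancel. -/
theorem hillVel_nat_mul (n : ℕ) : (-1) ^ n * hillVel 1 0 ξ 0 (n * (2 * s)) =
    n * (-(2 * hillSol 1 0 ξ 0 s / XDot s ξ 0) * F ξ 0 0) := by
  have he : |(0 : ℝ)| < 1 := by simp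
  induction n with
  | zero => simp [hillVel_init he]
  | succ k ih =>
    have h1 : F ((-1) ^ k * ξ) (k * (2 * s)) 0 = (-1) ^ k * F ξ 0 0 := by
      rcases neg_one_pow_eq_or ℝ k with hk | hk <;> simp [hk, F_zero]
    have h2 : ((-1 : ℝ) ^ k) * (-1) ^ k = 1 := by
      rw [← mul_pow]; norm_num
    push_cast
    rw [show ((k : ℝ) + 1) * (2 * s) = k * (2 * s) + 2 * s by ring, h.hillVel_add_two_mul,
      (h.X_nat_mul k).1, h1, pow_succ]
    linear_combination ih - (2 * hillSol 1 0 ξ 0 s / XDot s ξ 0) * F ξ 0 0 * h2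

/-- The even periodic solution is nondegenerate in the class of even solutions. -/
theorem hillVel_nat_mul_ne_zero {n : ℕ} (hn : 1 ≤ n) : hillVel 1 0 ξ 0 (n * (2 * s)) ≠ 0 := by
  have h1 := h.hillVel_nat_mul n
  intro h0
  rw [h0, mul_zero] at h1
  have hn' : (0 : ℝ) < n := by exact_mod_cast hn
  have h2 : 0 < -(2 * hillSol 1 0 ξ 0 s / XDot s ξ 0) := by
    rw [neg_pos]
    exact div_neg_of_pos_of_neg (by linarith [h.hillSol_pos]) h.XDot_neg
  have h3 := F_zero_pos h.start_pos 0
  have : 0 < n * (-(2 * hillSol 1 0 ξ 0 s / XDot s ξ 0) * F ξ 0 0) := by positivity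
  linarith

/-- The velocity, normalized, is the second fundamental solution of the linearization. -/
theorem hillSol_zero_one (t : ℝ) : hillSol 0 1 ξ 0 t = -XDot t ξ 0 / F ξ 0 0 ∧
    hillVel 0 1 ξ 0 t = F (X t ξ 0) t 0 / F ξ 0 0 := by
  have he : |(0 : ℝ)| < 1 := by simp
  have hF := (F_zero_pos h.start_pos 0).ne'
  refine hill_unique he (ξ := ξ) (t₀ := 0)
    (hasDerivAt_hillSol he 0 1 ξ) (hasDerivAt_hillVel he 0 1 ξ)
    (z := fun t => -XDot t ξ 0 / F ξ 0 0) (v := fun t => F (X t ξ 0) t 0 / F ξ 0 0)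
    (fun t => ?_) (fun t => ?_) ?_ ?_ t
  · refine ((hasDerivAt_XDot_zero t ξ).neg.div_const (F ξ 0 0)).congr_deriv ?_
    rw [neg_neg]
  · have := (hasDerivAt_neg_F_X_zero ξ t).neg.div_const (F ξ 0 0)
    simp only [Pi.neg_def, neg_neg] at this
    refine this.congr_deriv ?_
    ring
  · simp [hillSol_init he, XDot_init he]
  · simp only [hillVel_init he, X_init he, div_self hF]

end IsQuarterPeriod

end CircularHill

/-! ### Variations with respect to amplitude and eccentricity -/

section ParameterDependence

/-- Position, time and eccentricity, velocity, and the two fundamental solutions of the linearization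
together with their velocities. -/
abbrev Phase : Type := (ℝ × ℝ × ℝ) × ℝ × (ℝ × ℝ) × (ℝ × ℝ)

/-- The autonomous vector field of the Sitnikov equation together with its linearization. -/
noncomputable def phaseField (z : Phase) : Phase :=
  ((z.2.1, 1, 0), -F z.1.1 z.1.2.1 z.1.2.2,
    (z.2.2.1.2, -(Fx z.1.1 z.1.2.1 z.1.2.2 * z.2.2.1.1)),
    (z.2.2.2.2, -(Fx z.1.1 z.1.2.1 z.1.2.2 * z.2.2.2.1)))

/-- The trajectories of `phaseField` that start from the even data of the Sitnikov equation. -/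
noncomputable def phaseCurve (p : ℝ × ℝ) (t : ℝ) : Phase :=
  ((X t p.1 p.2, t, p.2), XDot t p.1 p.2,
    (hillSol 1 0 p.1 p.2 t, hillVel 1 0 p.1 p.2 t), (hillSol 0 1 p.1 p.2 t, hillVel 0 1 p.1 p.2 t))

theorem contDiffOn_phaseField : ContDiffOn ℝ 2 phaseField {z | |z.1.2.2| < 1} := by
  intro z hz
  have hF : ContDiffAt ℝ 2 (fun z : Phase => F z.1.1 z.1.2.1 z.1.2.2) z :=
    (contDiffAt_F (n := 2) two_ne_zero (w := z.1) hz).comp z contDiffAt_fst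
  have hFx : ContDiffAt ℝ 2 (fun z : Phase => Fx z.1.1 z.1.2.1 z.1.2.2) z :=
    (contDiffAt_Fx (n := 2) two_ne_zero (w := z.1) hz).comp z contDiffAt_fst
  refine ContDiffAt.contDiffWithinAt ?_
  unfold phaseField
  have h1 : ContDiffAt ℝ 2 (fun z : Phase => z.2.1) z := by fun_prop
  have h2 : ContDiffAt ℝ 2 (fun z : Phase => z.2.2.1.2) z := by fun_prop
  have h3 : ContDiffAt ℝ 2 (fun z : Phase => z.2.2.2.2) z := by fun_prop
  have h4 : ContDiffAt ℝ 2 (fun z : Phase => z.2.2.1.1) z := by fun_prop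
  have h5 : ContDiffAt ℝ 2 (fun z : Phase => z.2.2.2.1) z := by fun_prop
  exact (h1.prodMk (contDiffAt_const.prodMk contDiffAt_const)).prodMk
    (hF.neg.prodMk ((h2.prodMk (hFx.mul h4).neg).prodMk (h3.prodMk (hFx.mul h5).neg)))

theorem fderiv_phaseField {z : Phase} (hz : |z.1.2.2| < 1) (h : Phase) :
    fderiv ℝ phaseField z h =
      ((h.2.1, 0, 0), -fderiv ℝ (fun w : ℝ × ℝ × ℝ => F w.1 w.2.1 w.2.2) z.1 h.1,
        (h.2.2.1.2, -(Fx z.1.1 z.1.2.1 z.1.2.2 * h.2.2.1.1 +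
          z.2.2.1.1 * fderiv ℝ (fun w : ℝ × ℝ × ℝ => Fx w.1 w.2.1 w.2.2) z.1 h.1)),
        (h.2.2.2.2, -(Fx z.1.1 z.1.2.1 z.1.2.2 * h.2.2.2.1 +
          z.2.2.2.1 * fderiv ℝ (fun w : ℝ × ℝ × ℝ => Fx w.1 w.2.1 w.2.2) z.1 h.1))) := by
  have hF : HasFDerivAt (𝕜 := ℝ) (fun z : Phase => F z.1.1 z.1.2.1 z.1.2.2) _ z :=
    ((contDiffAt_F (n := 1) one_ne_zero (w := z.1) hz).differentiableAt
      (by simp)).hasFDerivAt.comp z hasFDerivAt_fst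
  have hFx : HasFDerivAt (𝕜 := ℝ) (fun z : Phase => Fx z.1.1 z.1.2.1 z.1.2.2) _ z :=
    ((contDiffAt_Fx (n := 1) one_ne_zero (w := z.1) hz).differentiableAt
      (by simp)).hasFDerivAt.comp z hasFDerivAt_fst
  have h0 : HasFDerivAt (fun z : Phase => z) (ContinuousLinearMap.id ℝ Phase) z := hasFDerivAt_id z
  have h1 := (h0.snd.fst.prodMk ((hasFDerivAt_const (1 : ℝ) z).prodMk
    (hasFDerivAt_const (0 : ℝ) z))).prodMk (hF.neg.prodMk
    ((h0.snd.snd.fst.snd.prodMk (hFx.mul h0.snd.snd.fst.fst).neg).prodMk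
      (h0.snd.snd.snd.snd.prodMk (hFx.mul h0.snd.snd.snd.fst).neg)))
  have h2 : HasFDerivAt (𝕜 := ℝ) phaseField _ z := h1
  rw [h2.fderiv]
  simp

theorem hasDerivAt_phaseCurve {p : ℝ × ℝ} (hp : |p.2| < 1) (t : ℝ) :
    HasDerivAt (phaseCurve p) (phaseField (phaseCurve p t)) t :=
  ((hasDerivAt_X hp t p.1).prodMk ((hasDerivAt_id t).prodMk (hasDerivAt_const t p.2))).prodMk
    ((hasDerivAt_XDot hp t p.1).prodMk
      (((hasDerivAt_hillSol hp 1 0 p.1 t).prodMk (hasDerivAt_hillVel hp 1 0 p.1 t)).prodMk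
        ((hasDerivAt_hillSol hp 0 1 p.1 t).prodMk (hasDerivAt_hillVel hp 0 1 p.1 t))))

/-- The derivative at the origin of `phaseCurve` in the parameters. -/
noncomputable def phaseInit : ℝ × ℝ →L[ℝ] Phase :=
  ((ContinuousLinearMap.fst ℝ ℝ ℝ).prod
    ((0 : ℝ × ℝ →L[ℝ] ℝ).prod (ContinuousLinearMap.snd ℝ ℝ ℝ))).prod 0

theorem phaseInit_apply (d : ℝ × ℝ) : phaseInit d = ((d.1, 0, d.2), 0) := rfl

/-- The derivatives `η, ν, α, α', β, β'` of `X, Ẋ, ψ₁, ψ̇₁, ψ₂, ψ̇₂` with respect to the parameters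
`(ξ, e)` in the direction `d`, on the time interval `[0, T]`. -/
structure IsVariation (p d : ℝ × ℝ) (T : ℝ) (η ν α α' β β' : ℝ → ℝ) : Prop where
  init : η 0 = d.1 ∧ ν 0 = 0 ∧ α 0 = 0 ∧ α' 0 = 0 ∧ β 0 = 0 ∧ β' 0 = 0
  deriv_η : ∀ t ∈ Icc 0 T, HasDerivAt η (ν t) t
  deriv_ν : ∀ t ∈ Icc 0 T, HasDerivAt ν
    (-fderiv ℝ (fun w : ℝ × ℝ × ℝ => F w.1 w.2.1 w.2.2) (X t p.1 p.2, t, p.2) (η t, 0, d.2)) t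
  deriv_α : ∀ t ∈ Icc 0 T, HasDerivAt α (α' t) t
  deriv_α' : ∀ t ∈ Icc 0 T, HasDerivAt α'
    (-(hillCoeff p.1 p.2 t * α t + hillSol 1 0 p.1 p.2 t *
      fderiv ℝ (fun w : ℝ × ℝ × ℝ => Fx w.1 w.2.1 w.2.2) (X t p.1 p.2, t, p.2) (η t, 0, d.2))) t
  deriv_β : ∀ t ∈ Icc 0 T, HasDerivAt β (β' t) t
  deriv_β' : ∀ t ∈ Icc 0 T, HasDerivAt β'
    (-(hillCoeff p.1 p.2 t * β t + hillSol 0 1 p.1 p.2 t *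
      fderiv ℝ (fun w : ℝ × ℝ × ℝ => Fx w.1 w.2.1 w.2.2) (X t p.1 p.2, t, p.2) (η t, 0, d.2))) t
  -- The set `S` allows one-sided curves, needed because families start at e = 0.
  curve : ∀ t ∈ Icc 0 T, ∀ (c : ℝ → ℝ × ℝ) (S : Set ℝ) (r : ℝ), c r = p →
    HasDerivWithinAt c d S r →
    HasDerivWithinAt (fun s => XDot t (c s).1 (c s).2) (ν t) S r ∧
    HasDerivWithinAt (fun s => hillSol 1 0 (c s).1 (c s).2 t) (α t) S r ∧
    HasDerivWithinAt (fun s => hillVel 0 1 (c s).1 (c s).2 t) (β' t) S r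

theorem eq_init_of_hasDerivAt_zero {T : ℝ} {f : ℝ → ℝ} (h : ∀ t ∈ Icc 0 T, HasDerivAt f 0 t) :
    ∀ t ∈ Icc 0 T, f t = f 0 :=
  constant_of_has_deriv_right_zero (fun t ht => (h t ht).continuousAt.continuousWithinAt)
    fun t ht => (h t (Ico_subset_Icc_self ht)).hasDerivWithinAt

/-- The variations are the components of the derivative of `phaseCurve` in the parameters, applied
to `d`. -/
theorem exists_isVariation {T : ℝ} (hT : 0 ≤ T) :
    (∀ (p d : ℝ × ℝ), |p.2| < 1 → ∃ η ν α α' β β', IsVariation p d T η ν α α' β β') ∧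
      ∀ t ∈ Icc 0 T, ContDiffOn ℝ 1 (fun p : ℝ × ℝ => XDot t p.1 p.2) {p | |p.2| < 1} := by
  have hU : IsOpen {z : Phase | |z.1.2.2| < 1} :=
    isOpen_lt (by fun_prop) continuous_const
  have hN : IsOpen {p : ℝ × ℝ | |p.2| < 1} := isOpen_lt (by fun_prop) continuous_const
  obtain ⟨Y, hY0, hY, hYd, hC⟩ := exists_variational_solution hU contDiffOn_phaseField hN hT
    (z := phaseCurve) phaseInit (fun p hp t _ => hasDerivAt_phaseCurve hp t)
    (fun p hp t _ => hp)
    (fun p hp q hq => by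
      simp [phaseCurve, phaseInit_apply, X_init hp, X_init hq, XDot_init hp, XDot_init hq,
        hillSol_init hp, hillSol_init hq, hillVel_init hp, hillVel_init hq])
  refine ⟨fun p d hp => ?_, fun t ht => ?_⟩
  · have hy : ∀ t ∈ Icc 0 T, HasDerivAt (fun t => Y p t d)
        (fderiv ℝ phaseField (phaseCurve p t) (Y p t d)) t := fun t ht => by
      simpa using (hY p hp t ht).clm_apply (hasDerivAt_const t d)
    have hproj : ∀ (π : Phase →L[ℝ] ℝ), ∀ t ∈ Icc 0 T, HasDerivAt (fun t => π (Y p t d))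
        (π (fderiv ℝ phaseField (phaseCurve p t) (Y p t d))) t := fun π t ht =>
      π.hasFDerivAt.comp_hasDerivAt t (hy t ht)
    have hfd := fun t => fderiv_phaseField (z := phaseCurve p t) hp (Y p t d)
    have hinit : Y p 0 d = ((d.1, 0, d.2), 0) := by rw [hY0 p hp, phaseInit_apply]
    let f₁ := ContinuousLinearMap.fst ℝ (ℝ × ℝ × ℝ) (ℝ × (ℝ × ℝ) × (ℝ × ℝ))
    let f₂ := ContinuousLinearMap.snd ℝ (ℝ × ℝ × ℝ) (ℝ × (ℝ × ℝ) × (ℝ × ℝ))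
    let g₂ := (ContinuousLinearMap.snd ℝ ℝ ((ℝ × ℝ) × (ℝ × ℝ))).comp f₂
    let k₁ := (ContinuousLinearMap.fst ℝ (ℝ × ℝ) (ℝ × ℝ)).comp g₂
    let k₂ := (ContinuousLinearMap.snd ℝ (ℝ × ℝ) (ℝ × ℝ)).comp g₂
    let a := ContinuousLinearMap.fst ℝ ℝ ℝ
    let b := ContinuousLinearMap.snd ℝ ℝ ℝ
    -- Time and eccentricity have constant speed in the phase field, so their variations keep the
    -- initial values 0 and d.2.
    have hσ : ∀ t ∈ Icc 0 T, (Y p t d).1.2.1 = 0 := fun t ht => by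
      have := eq_init_of_hasDerivAt_zero (f := fun t => (Y p t d).1.2.1) (fun t ht => by
        have := hproj ((a.comp (ContinuousLinearMap.snd ℝ ℝ (ℝ × ℝ))).comp f₁) t ht
        rw [hfd] at this
        exact this) t ht
      rw [this, hinit]
    have hε : ∀ t ∈ Icc 0 T, (Y p t d).1.2.2 = d.2 := fun t ht => by
      have := eq_init_of_hasDerivAt_zero (f := fun t => (Y p t d).1.2.2) (fun t ht => by
        have := hproj ((b.comp (ContinuousLinearMap.snd ℝ ℝ (ℝ × ℝ))).comp f₁) t ht
        rw [hfd] at this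
        exact this) t ht
      rw [this, hinit]
    have h1 : ∀ t ∈ Icc 0 T, (Y p t d).1 = ((Y p t d).1.1, 0, d.2) := fun t ht =>
      Prod.ext rfl (Prod.ext (hσ t ht) (hε t ht))
    refine ⟨fun t => (Y p t d).1.1, fun t => (Y p t d).2.1, fun t => (Y p t d).2.2.1.1,
      fun t => (Y p t d).2.2.1.2, fun t => (Y p t d).2.2.2.1, fun t => (Y p t d).2.2.2.2, ?_⟩
    refine ⟨by simp [hinit], fun t ht => ?_, fun t ht => ?_, fun t ht => ?_, fun t ht => ?_,
      fun t ht => ?_, fun t ht => ?_, fun t ht c S r hc hcd => ?_⟩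
    · have := hproj ((ContinuousLinearMap.fst ℝ ℝ (ℝ × ℝ)).comp f₁) t ht
      rw [hfd] at this
      exact this
    · have := hproj ((ContinuousLinearMap.fst ℝ ℝ ((ℝ × ℝ) × (ℝ × ℝ))).comp f₂) t ht
      rw [hfd, h1 t ht] at this
      exact this
    · have := hproj (a.comp k₁) t ht
      rw [hfd] at this
      exact this
    · have := hproj (b.comp k₁) t ht
      rw [hfd, h1 t ht] at this
      exact this
    · have := hproj (a.comp k₂) t ht
      rw [hfd] at this
      exact this
    · have := hproj (b.comp k₂) t ht
      rw [hfd, h1 t ht] at this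
      exact this
    · subst hc
      have h2 : HasDerivWithinAt (fun s => phaseCurve (c s) t) (Y (c r) t d) S r :=
        (hYd (c r) hp t ht).comp_hasDerivWithinAt r hcd
      have h3 := fun π : Phase →L[ℝ] ℝ => π.hasFDerivAt.comp_hasDerivWithinAt r h2
      exact ⟨h3 ((ContinuousLinearMap.fst ℝ ℝ ((ℝ × ℝ) × (ℝ × ℝ))).comp f₂), h3 (a.comp k₁),
        h3 (b.comp k₂)⟩
  · exact (contDiff_fst.comp contDiff_snd).comp_contDiffOn (hC t ht)

/-- Reduces a directional derivative at e = 0 to one-variable calculus along a line. -/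
theorem fderiv_eq_of_hasDerivAt_curve {f : ℝ × ℝ × ℝ → ℝ} {x t η ε D : ℝ}
    (hf : ContDiffAt ℝ 1 f (x, t, 0))
    (hD : HasDerivAt (fun s : ℝ => f (x + s * η, t, s * ε)) D 0) :
    fderiv ℝ f (x, t, 0) (η, 0, ε) = D := by
  have hc : HasDerivAt (fun s : ℝ => ((x + s * η, t, s * ε) : ℝ × ℝ × ℝ)) (η, 0, ε) 0 := by
    have h1 : HasDerivAt (fun s : ℝ => x + s * η) η 0 := by
      simpa using ((hasDerivAt_id (0 : ℝ)).mul_const η).const_add x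
    have h2 : HasDerivAt (fun s : ℝ => s * ε) ε 0 := by
      simpa using (hasDerivAt_id (0 : ℝ)).mul_const ε
    exact h1.prodMk ((hasDerivAt_const _ _).prodMk h2)
  have h3 : HasFDerivAt f (fderiv ℝ f (x, t, 0)) (x + 0 * η, t, 0 * ε) := by
    simpa using (hf.differentiableAt (by simp)).hasFDerivAt
  exact (h3.comp_hasDerivAt (0 : ℝ) hc).unique hD

theorem hasDerivAt_sq_add_radius_sq_curve (x t η ε : ℝ) :
    HasDerivAt (fun s : ℝ => (x + s * η) ^ 2 + radius t (s * ε) ^ 2)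
      (2 * x * η - 1 / 2 * Real.cos t * ε) 0 := by
  have h1 : HasDerivAt (fun s : ℝ => x + s * η) η 0 := by
    simpa using ((hasDerivAt_id (0 : ℝ)).mul_const η).const_add x
  have h2 : HasDerivAt (fun s : ℝ => s * ε) ε 0 := by
    simpa using (hasDerivAt_id (0 : ℝ)).mul_const ε
  have h3 : HasDerivAt (fun e => radius t e) (-(1 / 2) * Real.cos t) (0 * ε) := by
    simpa using hasDerivAt_radius_zero t
  refine ((h1.pow 2).add ((h3.comp (0 : ℝ) h2).pow 2)).congr_deriv ?_
  simp [radius_zero]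
  ring

theorem hasDerivAt_rpow_curve (x t η ε r : ℝ) :
    HasDerivAt (fun s : ℝ => ((x + s * η) ^ 2 + radius t (s * ε) ^ 2) ^ r)
      ((2 * x * η - 1 / 2 * Real.cos t * ε) * r * (x ^ 2 + 1 / 4) ^ (r - 1)) 0 := by
  have h0 : (x + 0 * η) ^ 2 + radius t (0 * ε) ^ 2 = x ^ 2 + 1 / 4 := by
    rw [zero_mul, zero_mul, radius_zero]; norm_num
  have := (hasDerivAt_sq_add_radius_sq_curve x t η ε).rpow_const (p := r)
    (Or.inl (by rw [h0]; positivity))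
  rwa [h0] at this

theorem fderiv_F_zero (x t η ε : ℝ) :
    fderiv ℝ (fun w : ℝ × ℝ × ℝ => F w.1 w.2.1 w.2.2) (x, t, 0) (η, 0, ε) =
      Fx x t 0 * η + 3 / 4 * x * (x ^ 2 + 1 / 4) ^ (-(5 / 2) : ℝ) * Real.cos t * ε := by
  refine fderiv_eq_of_hasDerivAt_curve (contDiffAt_F (n := 1) one_ne_zero (by simp)) ?_
  have h1 : HasDerivAt (fun s : ℝ => x + s * η) η 0 := by
    simpa using ((hasDerivAt_id (0 : ℝ)).mul_const η).const_add x
  have h2 := h1.mul (hasDerivAt_rpow_curve x t η ε (-(3 / 2)))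
  have hev : ∀ᶠ s : ℝ in 𝓝 0, |s * ε| < 1 := by
    have : Continuous fun s : ℝ => |s * ε| := by fun_prop
    exact (this.tendsto 0).eventually_lt_const (by simp)
  refine (h2.congr_of_eventuallyEq ?_).congr_deriv ?_
  · filter_upwards [hev] with s hs
    exact F_eq hs _ _
  · rw [Fx_zero]
    simp only [zero_mul, add_zero, radius_zero]
    rw [show (-(3 / 2) - 1 : ℝ) = -(5 / 2) by norm_num, show ((1 / 2 : ℝ) ^ 2) = 1 / 4 by norm_num]
    ring

theorem fderiv_Fx_zero (x t η ε : ℝ) :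
    fderiv ℝ (fun w : ℝ × ℝ × ℝ => Fx w.1 w.2.1 w.2.2) (x, t, 0) (η, 0, ε) =
      (-9 * x * (x ^ 2 + 1 / 4) ^ (-(5 / 2) : ℝ) +
        15 * x ^ 3 * (x ^ 2 + 1 / 4) ^ (-(7 / 2) : ℝ)) * η +
      (3 / 4 * (x ^ 2 + 1 / 4) ^ (-(5 / 2) : ℝ) -
        15 / 4 * x ^ 2 * (x ^ 2 + 1 / 4) ^ (-(7 / 2) : ℝ)) * Real.cos t * ε := by
  refine fderiv_eq_of_hasDerivAt_curve (contDiffAt_Fx (n := 1) one_ne_zero (by simp)) ?_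
  have h1 : HasDerivAt (fun s : ℝ => x + s * η) η 0 := by
    simpa using ((hasDerivAt_id (0 : ℝ)).mul_const η).const_add x
  have h2 := (hasDerivAt_rpow_curve x t η ε (-(3 / 2))).sub
    (((h1.pow 2).const_mul 3).mul (hasDerivAt_rpow_curve x t η ε (-(5 / 2))))
  have h3 : HasDerivAt (fun s : ℝ => Fx (x + s * η) t (s * ε)) _ 0 := h2
  refine h3.congr_deriv ?_
  simp only [zero_mul, add_zero, radius_zero, Pi.pow_apply]
  rw [show (-(3 / 2) - 1 : ℝ) = -(5 / 2) by norm_num,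
    show (-(5 / 2) - 1 : ℝ) = -(7 / 2) by norm_num, show ((1 / 2 : ℝ) ^ 2) = 1 / 4 by norm_num]
  push_cast
  ring

end ParameterDependence

/-! ### Continuation of even periodic solutions -/

section Existence

/-- A nondegenerate even periodic solution of the circular problem continues to small
eccentricities. -/
theorem IsQuarterPeriod.exists_isEvenFamily {ξ s : ℝ} (h : IsQuarterPeriod ξ s) {m p : ℕ}
    (hp : 1 ≤ p) (hs : p * (2 * s) = m * Real.pi) : ∃ e₀ Ξ, IsEvenFamily m p e₀ Ξ := by
  have hp0 : (0 : ℝ) < p := by exact_mod_cast hp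
  have hT : 0 ≤ m * Real.pi := by positivity
  obtain ⟨hvar, hC⟩ := exists_isVariation hT
  have hTmem : m * Real.pi ∈ Icc 0 (m * Real.pi) := ⟨hT, le_rfl⟩
  obtain ⟨η, ν, α, α', β, β', hv⟩ := hvar (ξ, 0) (1, 0) (by simp)
  -- In the direction (1, 0) the variational equation is Hill's equation with data (1, 0), so ν =
  -- ψ̇₁.
  have hν : ν (m * Real.pi) ≠ 0 := by
    have := hill_unique_Icc (e := 0) (by simp) (ξ := ξ) (y := η) (w := ν) (z := hillSol 1 0 ξ 0)
      (v := hillVel 1 0 ξ 0) hv.deriv_η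
      (fun t ht => (hv.deriv_ν t ht).congr_deriv (by
        simp only [fderiv_F_zero, mul_zero, add_zero]
        rfl))
      (fun t _ => hasDerivAt_hillSol (by simp) 1 0 ξ t)
      (fun t _ => hasDerivAt_hillVel (by simp) 1 0 ξ t)
      (by rw [hv.init.1, hillSol_init (by simp)])
      (by rw [hv.init.2.1, hillVel_init (by simp)]) hTmem
    rw [this.2, ← hs]
    exact h.hillVel_nat_mul_ne_zero hp
  -- The eccentricity comes first because the implicit function theorem solves for the second
  -- variable, here ξ.
  set f : ℝ × ℝ → ℝ := fun q => XDot (m * Real.pi) q.2 q.1 with hf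
  have hN : IsOpen {p : ℝ × ℝ | |p.2| < 1} := isOpen_lt (by fun_prop) continuous_const
  have hcd : ContDiffAt ℝ 1 f (0, ξ) := by
    have h1 : ContDiffAt ℝ 1 (fun p : ℝ × ℝ => XDot (m * Real.pi) p.1 p.2) (ξ, 0) :=
      (hC _ hTmem).contDiffAt (hN.mem_nhds (by simp))
    exact h1.comp (0, ξ) (f := fun q : ℝ × ℝ => (q.2, q.1)) (by fun_prop)
  have hinv : (fderiv ℝ f (0, ξ) ∘L .inr ℝ ℝ ℝ).IsInvertible := by
    refine ⟨ContinuousLinearEquiv.unitsEquivAut ℝ (Units.mk0 _ hν), ?_⟩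
    have hid := hasDerivAt_id ξ
    have h1 := (hcd.differentiableAt one_ne_zero).hasFDerivAt.comp_hasDerivAt ξ
      ((hasDerivAt_const ξ (0 : ℝ)).prodMk hid)
    have h2 := (hv.curve _ hTmem (fun r => (r, 0)) univ ξ rfl
      (hid.prodMk (hasDerivAt_const ξ (0 : ℝ))).hasDerivWithinAt).1.hasDerivAt univ_mem
    have h3 := h1.unique h2
    ext
    simp only [ContinuousLinearEquiv.coe_coe, ContinuousLinearMap.comp_apply,
      ContinuousLinearMap.inr_apply]
    rw [h3]
    simp
  set Ξ := hcd.implicitFunction one_ne_zero hinv with hΞ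
  have hΞ0 : Ξ 0 = ξ := hcd.implicitFunction_apply_self one_ne_zero hinv
  have hΞc : ContDiffAt ℝ 1 Ξ 0 := hcd.contDiffAt_implicitFunction one_ne_zero hinv
  have hf0 : f (0, ξ) = 0 := by
    simp only [hf]
    rw [← hs]
    exact (h.X_nat_mul p).2
  have hev := (hcd.eventually_apply_implicitFunction one_ne_zero hinv).and
    (hΞc.eventually (by simp))
  obtain ⟨ε, hε, hball⟩ := Metric.eventually_nhds_iff.1 hev
  have hmem : ∀ e ∈ Ico 0 (min ε 1), dist e 0 < ε := fun e he => by
    rw [dist_zero_right, Real.norm_eq_abs, abs_of_nonneg he.1]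
    exact he.2.trans_le (min_le_left _ _)
  refine ⟨min ε 1, Ξ, lt_min hε one_pos, min_le_right _ _,
    fun e he => (hball (hmem e he)).2.contDiffWithinAt, ?_, ?_, fun e he => ?_⟩
  · rw [hΞ0]; exact h.start_pos
  · rw [hΞ0]
    have : 2 * m * Real.pi / p = 4 * s := by
      rw [div_eq_iff hp0.ne']; linarith
    rw [this]
    exact h.hasMinimalPeriod
  · have := (hball (hmem e he)).1
    rw [hf0] at this
    exact this

end Existence

/-! ### The derivative of the trace -/

section TraceDerivative

/-- The first Fourier coefficient of a function whose period does not allow for it vanishes. -/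
theorem integral_mul_cos_eq_zero {h : ℝ → ℝ} (hc : Continuous h) {σ T : ℝ}
    (hσ : Periodic h σ) (hT : Periodic h T) (hcosT : Periodic Real.cos T)
    (hsinT : Periodic Real.sin T) (h1 : Real.cos σ ≠ 1) :
    ∫ t in (0 : ℝ)..T, h t * Real.cos t = 0 := by
  have hi : ∀ g : ℝ → ℝ, Continuous g →
      IntervalIntegrable (fun t => h t * g t) MeasureTheory.volume 0 T := fun g hg =>
    (hc.mul hg).intervalIntegrable _ _
  have hshift : ∀ g : ℝ → ℝ, Periodic g T →
      ∫ t in (0 : ℝ)..T, h t * g t = ∫ t in (0 : ℝ)..T, h t * g (t + σ) := by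
    intro g hg
    have hper : Periodic (fun t => h t * g t) T := hT.mul hg
    have h2 := hper.intervalIntegral_add_eq 0 (0 + σ)
    rw [show (0 : ℝ) + σ + T = T + σ by ring, zero_add T,
      ← intervalIntegral.integral_comp_add_right (fun t => h t * g t) σ] at h2
    rw [h2]
    simp only [hσ _]
  set A := ∫ t in (0 : ℝ)..T, h t * Real.cos t with hA
  set B := ∫ t in (0 : ℝ)..T, h t * Real.sin t with hB
  have hA' : A = Real.cos σ * A - Real.sin σ * B := by
    conv_lhs => rw [hA, hshift _ hcosT]
    rw [hA, hB, ← intervalIntegral.integral_const_mul, ← intervalIntegral.integral_const_mul,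
      ← intervalIntegral.integral_sub ((hi _ Real.continuous_cos).const_mul _)
        ((hi _ Real.continuous_sin).const_mul _)]
    congr 1
    funext t
    rw [Real.cos_add]; ring
  have hB' : B = Real.sin σ * A + Real.cos σ * B := by
    conv_lhs => rw [hB, hshift _ hsinT]
    rw [hA, hB, ← intervalIntegral.integral_const_mul, ← intervalIntegral.integral_const_mul,
      ← intervalIntegral.integral_add ((hi _ Real.continuous_cos).const_mul _)
        ((hi _ Real.continuous_sin).const_mul _)]
    congr 1
    funext t
    rw [Real.sin_add]; ring
  -- Translation by σ rotates (A, B) by the angle σ; 2(1 - cos σ) is the determinant of identity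
  -- minus rotation.
  have h3 : 2 * (1 - Real.cos σ) * A = 0 := by
    linear_combination (1 - Real.cos σ) * hA' - Real.sin σ * hB' -
      A * Real.sin_sq_add_cos_sq σ
  rcases mul_eq_zero.1 h3 with h4 | h4
  · exact absurd (by linarith) h1
  · exact h4

theorem hasDerivAt_rpow_X_zero (ξ t r : ℝ) :
    HasDerivAt (fun t => (X t ξ 0 ^ 2 + 1 / 4) ^ r)
      (2 * X t ξ 0 * XDot t ξ 0 * r * (X t ξ 0 ^ 2 + 1 / 4) ^ (r - 1)) t := by
  have h1 : HasDerivAt (fun t => X t ξ 0 ^ 2 + 1 / 4) (2 * X t ξ 0 * XDot t ξ 0) t := by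
    refine (((hasDerivAt_X_zero t ξ).pow 2).add_const (1 / 4)).congr_deriv ?_
    push_cast; ring
  exact h1.rpow_const (Or.inl (by positivity))

theorem hasDerivAt_hillCoeff_zero (ξ t : ℝ) : HasDerivAt (hillCoeff ξ 0)
    ((-9 * X t ξ 0 * (X t ξ 0 ^ 2 + 1 / 4) ^ (-(5 / 2) : ℝ) +
        15 * X t ξ 0 ^ 3 * (X t ξ 0 ^ 2 + 1 / 4) ^ (-(7 / 2) : ℝ)) * XDot t ξ 0) t := by
  have h1 := (hasDerivAt_rpow_X_zero ξ t (-(3 / 2))).sub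
    ((((hasDerivAt_X_zero t ξ).pow 2).const_mul 3).mul (hasDerivAt_rpow_X_zero ξ t (-(5 / 2))))
  have h2 : hillCoeff ξ 0 = fun t => (X t ξ 0 ^ 2 + 1 / 4) ^ (-(3 / 2) : ℝ) -
    3 * X t ξ 0 ^ 2 * (X t ξ 0 ^ 2 + 1 / 4) ^ (-(5 / 2) : ℝ) := funext (hillCoeff_zero ξ)
  rw [h2]
  refine HasDerivAt.congr_deriv h1 ?_
  rw [show (-(3 / 2) - 1 : ℝ) = -(5 / 2) by norm_num,
    show (-(5 / 2) - 1 : ℝ) = -(7 / 2) by norm_num]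
  simp only [Pi.pow_apply]
  push_cast
  ring

namespace IsQuarterPeriod

variable {ξ s : ℝ} (h : IsQuarterPeriod ξ s)
include h

/-- ψ₂ is a multiple of the periodic velocity; constancy of the Wronskian then forces ψ₁ = 1 there.
-/
theorem fundamental_at_period (n : ℕ) :
    hillSol 1 0 ξ 0 ((2 * n : ℕ) * (2 * s)) = 1 ∧ hillSol 0 1 ξ 0 ((2 * n : ℕ) * (2 * s)) = 0 ∧
      hillVel 0 1 ξ 0 ((2 * n : ℕ) * (2 * s)) = 1 := by
  have he : |(0 : ℝ)| < 1 := by simp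
  obtain ⟨hX, hV⟩ := h.X_nat_mul (2 * n)
  set T : ℝ := (2 * n : ℕ) * (2 * s) with hT
  rw [pow_mul, neg_one_sq, one_pow, one_mul] at hX
  have hT0 : 0 ≤ T := by have := h.pos; positivity
  have h2 : hillSol 0 1 ξ 0 T = 0 := by rw [(h.hillSol_zero_one T).1, hV]; simp
  have h3 : hillVel 0 1 ξ 0 T = 1 := by
    rw [(h.hillSol_zero_one T).2, hX]
    have : F ξ T 0 = F ξ 0 0 := by rw [F_zero, F_zero]
    rw [this, div_self (F_zero_pos h.start_pos 0).ne']
  have h4 := eq_init_of_hasDerivAt_zero (T := T)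
    (f := fun t => hillSol 1 0 ξ 0 t * hillVel 0 1 ξ 0 t - hillVel 1 0 ξ 0 t * hillSol 0 1 ξ 0 t)
    (fun t _ => by
      refine (((hasDerivAt_hillSol he 1 0 ξ t).mul (hasDerivAt_hillVel he 0 1 ξ t)).sub
        ((hasDerivAt_hillVel he 1 0 ξ t).mul (hasDerivAt_hillSol he 0 1 ξ t))).congr_deriv ?_
      ring) T ⟨hT0, le_rfl⟩
  rw [h2, h3, hillSol_init he, hillSol_init he, hillVel_init he, hillVel_init he] at h4
  exact ⟨by linarith, h2, h3⟩

/-- The first variation of the trace is a multiple of the variation of the second fundamental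
solution. -/
theorem variation_trace {n : ℕ} {a : ℝ} {η ν α α' β β' : ℝ → ℝ}
    (hv : IsVariation (ξ, 0) (a, 1) ((2 * n : ℕ) * (2 * s)) η ν α α' β β') :
    α ((2 * n : ℕ) * (2 * s)) + β' ((2 * n : ℕ) * (2 * s)) =
      β ((2 * n : ℕ) * (2 * s)) * hillVel 1 0 ξ 0 ((2 * n : ℕ) * (2 * s)) := by
  have he : |(0 : ℝ)| < 1 := by simp
  obtain ⟨h1, h2, h3⟩ := h.fundamental_at_period n
  have hT0 : (0 : ℝ) ≤ (2 * n : ℕ) * (2 * s) := by have := h.pos; positivity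
  -- Minus the variation of the Wronskian of ψ₁ and ψ₂; the two source terms cancel.
  have h4 := eq_init_of_hasDerivAt_zero
    (f := fun t => α' t * hillSol 0 1 ξ 0 t - α t * hillVel 0 1 ξ 0 t -
      (β' t * hillSol 1 0 ξ 0 t - β t * hillVel 1 0 ξ 0 t))
    (fun t ht => by
      refine ((((hv.deriv_α' t ht).mul (hasDerivAt_hillSol he 0 1 ξ t)).sub
        ((hv.deriv_α t ht).mul (hasDerivAt_hillVel he 0 1 ξ t))).sub
        (((hv.deriv_β' t ht).mul (hasDerivAt_hillSol he 1 0 ξ t)).sub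
        ((hv.deriv_β t ht).mul (hasDerivAt_hillVel he 1 0 ξ t)))).congr_deriv ?_
      ring) _ ⟨hT0, le_rfl⟩
  obtain ⟨-, -, i1, i2, i3, i4⟩ := hv.init
  simp only [h1, h2, h3, i1, i2, i3, i4] at h4
  linarith

/-- The core of the argument: ν + cβ satisfies Hill's equation with a source whose pairing with ẋ is
a first Fourier coefficient, after integration by parts. -/
theorem variation_hillSol_eq_zero {n m : ℕ} (hT : (2 * n : ℕ) * (2 * s) = m * (2 * Real.pi))
    (hcos : Real.cos (2 * s) ≠ 1) {a : ℝ} {η ν α α' β β' : ℝ → ℝ}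
    (hv : IsVariation (ξ, 0) (a, 1) ((2 * n : ℕ) * (2 * s)) η ν α α' β β')
    (hν : ν ((2 * n : ℕ) * (2 * s)) = 0) : β ((2 * n : ℕ) * (2 * s)) = 0 := by
  have he : |(0 : ℝ)| < 1 := by simp
  have hF := F_zero_pos h.start_pos 0
  set c := F ξ 0 0 with hc
  obtain ⟨hXT, hVT⟩ := h.X_nat_mul (2 * n)
  rw [pow_mul, neg_one_sq, one_pow, one_mul] at hXT
  have hT0 : (0 : ℝ) ≤ (2 * n : ℕ) * (2 * s) := by have := h.pos; positivity
  -- Chosen so that ġ = (3/4) x ẋ (x² + 1/4)^(-5/2), the amplitude of the source times ẋ.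
  set g : ℝ → ℝ := fun t => -(1 / 4) * (X t ξ 0 ^ 2 + 1 / 4) ^ (-(3 / 2) : ℝ) with hg
  have hgσ : Periodic g (2 * s) := fun t => by simp only [hg, (h.X_add_two_mul t).1, neg_sq]
  have hgc : Continuous g := continuous_const.mul
    (continuous_iff_continuousAt.2 fun t => (hasDerivAt_rpow_X_zero ξ t _).continuousAt)
  have hint : ∫ t in (0 : ℝ)..((2 * n : ℕ) * (2 * s)), g t * Real.cos t = 0 := by
    refine integral_mul_cos_eq_zero hgc hgσ (hgσ.nat_mul _) ?_ ?_ hcos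
    · rw [hT]; exact Real.cos_periodic.nat_mul m
    · rw [hT]; exact Real.sin_periodic.nat_mul m
  have hψ : ∀ t, XDot t ξ 0 = -c * hillSol 0 1 ξ 0 t := fun t => by
    rw [(h.hillSol_zero_one t).1, ← hc]; field_simp
  -- The Wronskian of ν + cβ and ẋ, minus g sin t. Its derivative ġ sin t - (g sin t)˙ leaves only
  -- -g cos t, since ẋ = -cψ₂ cancels the other source terms.
  have hd : ∀ t ∈ Icc 0 ((2 * n : ℕ) * (2 * s)), HasDerivAt
      (fun t => (-(hillCoeff ξ 0 t * η t + 3 / 4 * X t ξ 0 *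
        (X t ξ 0 ^ 2 + 1 / 4) ^ (-(5 / 2) : ℝ) * Real.cos t) + c * β' t) * XDot t ξ 0 -
        (ν t + c * β t) * -F (X t ξ 0) t 0 - g t * Real.sin t) (-(g t * Real.cos t)) t := by
    intro t ht
    have hν' := (hv.deriv_ν t ht).congr_deriv
      (g' := -(hillCoeff ξ 0 t * η t + 3 / 4 * X t ξ 0 *
        (X t ξ 0 ^ 2 + 1 / 4) ^ (-(5 / 2) : ℝ) * Real.cos t)) (by
        simp only [fderiv_F_zero, mul_one]; rfl)
    have hβ' := hv.deriv_β' t ht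
    rw [fderiv_Fx_zero, mul_one] at hβ'
    have h1 := ((((hasDerivAt_hillCoeff_zero ξ t).mul (hv.deriv_η t ht)).add
      ((((hasDerivAt_X_zero t ξ).const_mul (3 / 4)).mul
        (hasDerivAt_rpow_X_zero ξ t (-(5 / 2)))).mul (Real.hasDerivAt_cos t))).neg.add
      (hβ'.const_mul c)).mul (hasDerivAt_XDot_zero t ξ)
    have h2 := (hν'.add ((hv.deriv_β t ht).const_mul c)).mul (hasDerivAt_neg_F_X_zero ξ t)
    have h3 := ((hasDerivAt_rpow_X_zero ξ t (-(3 / 2))).const_mul (-(1 / 4))).mul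
      (Real.hasDerivAt_sin t)
    refine ((h1.sub h2).sub h3).congr_deriv ?_
    simp only [Pi.mul_apply, Pi.add_apply, Pi.neg_apply, hg]
    rw [show (-(3 / 2) - 1 : ℝ) = -(5 / 2) by norm_num,
      show (-(5 / 2) - 1 : ℝ) = -(7 / 2) by norm_num]
    rw [hψ t]
    ring
  have hftc := intervalIntegral.integral_eq_sub_of_hasDerivAt
    (fun t ht => hd t (by rwa [uIcc_of_le hT0] at ht))
    ((hgc.mul Real.continuous_cos).neg.intervalIntegrable _ _)
  rw [intervalIntegral.integral_neg, hint] at hftc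
  have hsinT : Real.sin ((2 * n : ℕ) * (2 * s)) = 0 := by
    rw [hT]
    simpa using Real.sin_periodic.nat_mul m 0
  have hFT : F ξ ((2 * n : ℕ) * (2 * s)) 0 = c := by rw [hc, F_zero, F_zero]
  simp only [hVT, XDot_init he, hXT, X_init he, hν, hv.init.1, hv.init.2.1, hv.init.2.2.2.2.1,
    hsinT, Real.sin_zero, mul_zero, hFT] at hftc
  have : c * c * β ((2 * n : ℕ) * (2 * s)) = 0 := by linarith
  rcases mul_eq_zero.1 this with h1 | h1
  · exact absurd h1 (mul_pos hF hF).ne'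
  · exact h1

end IsQuarterPeriod

/-- cos(mπ/p) = 1 would mean m = 2kp, where positivity of m and p forces k ≥ 1. -/
theorem cos_ne_one_of_ne {m p : ℕ} (hm : 1 ≤ m) (hp : 1 ≤ p)
    (hne : ∀ n : ℕ, 1 ≤ n → (p : ℝ) / m ≠ 1 / (2 * n)) : Real.cos (m * Real.pi / p) ≠ 1 := by
  have hp0 : (0 : ℝ) < p := by exact_mod_cast hp
  have hm0 : (0 : ℝ) < m := by exact_mod_cast hm
  intro h
  obtain ⟨k, hk⟩ := (Real.cos_eq_one_iff _).1 h
  have hk' : (k : ℝ) * (2 * p) = m := by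
    rw [eq_div_iff hp0.ne'] at hk
    have : Real.pi * ((k : ℝ) * (2 * p)) = Real.pi * m := by linarith
    exact mul_left_cancel₀ Real.pi_ne_zero this
  have hk0 : 0 < k := by
    by_contra! hcon
    have h1 : (k : ℝ) ≤ 0 := by exact_mod_cast hcon
    nlinarith
  lift k to ℕ using hk0.le
  rw [Int.cast_natCast] at hk'
  have hk1 : 1 ≤ k := by exact_mod_cast hk0
  have hkpos : (0 : ℝ) < k := by exact_mod_cast hk0
  refine hne k hk1 ?_
  rw [div_eq_div_iff hm0.ne' (by positivity)]
  linarith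

theorem hasDerivWithinAt_trace {m p : ℕ} (hm : 1 ≤ m) (hp : 1 ≤ p)
    (hne : ∀ n : ℕ, 1 ≤ n → (p : ℝ) / m ≠ 1 / (2 * n)) {e₀ : ℝ} {Ξ : ℝ → ℝ}
    (hΞ : IsEvenFamily m p e₀ Ξ) : HasDerivWithinAt (trace m Ξ) 0 (Ici 0) 0 := by
  have hp0 : (0 : ℝ) < p := by exact_mod_cast hp
  have hq := isQuarterPeriod_of_hasMinimalPeriod hΞ.start_pos hΞ.start_period
  set s := 2 * m * Real.pi / p / 4 with hs
  have h2s : 2 * s = m * Real.pi / p := by rw [hs]; ring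
  have hT : (2 * p : ℕ) * (2 * s) = m * (2 * Real.pi) := by
    rw [h2s]; push_cast; field_simp
  have hT0 : (0 : ℝ) ≤ (2 * p : ℕ) * (2 * s) := by have := hq.pos; positivity
  have h0 : (0 : ℝ) ∈ Ico 0 e₀ := ⟨le_rfl, hΞ.pos⟩
  have habs : ∀ e ∈ Ico 0 e₀, |e| < 1 := fun e he => by
    rw [abs_of_nonneg he.1]; exact he.2.trans_le hΞ.le_one
  have hd := (hΞ.contDiffOn.differentiableOn one_ne_zero 0 h0).hasDerivWithinAt
  obtain ⟨η, ν, α, α', β, β', hv⟩ := (exists_isVariation hT0).1 (Ξ 0, 0)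
    (derivWithin Ξ (Ico 0 e₀) 0, 1) (by simp)
  have huniq : UniqueDiffWithinAt ℝ (Ico 0 e₀) 0 := uniqueDiffOn_Ico 0 e₀ 0 h0
  obtain ⟨c1, c2, c3⟩ := hv.curve _ ⟨hT0, le_rfl⟩ (fun e => (Ξ e, e)) (Ico 0 e₀) 0 rfl
    (hd.prodMk (hasDerivWithinAt_id 0 _))
  -- By evenness and rest at mπ, each member of the family is 2mπ-periodic, so its velocity at 2mπ
  -- is zero for every e.
  have hν : ν ((2 * p : ℕ) * (2 * s)) = 0 := by
    refine huniq.eq_deriv _ (c1.congr_of_mem (f₁ := fun _ => 0) (fun e he => ?_) h0)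
      (hasDerivWithinAt_const 0 _ 0)
    have h1 := (X_add_of_XDot_eq_zero (habs e he) (hΞ.deriv_eq_zero e he) 0).2
    rw [zero_add, XDot_init (habs e he), ← hT] at h1
    exact h1.symm
  have hβ := hq.variation_hillSol_eq_zero hT
    (by rw [h2s]; exact cos_ne_one_of_ne hm hp hne) hv hν
  have htr := hq.variation_trace hv
  rw [hβ, zero_mul] at htr
  have hsum := c2.add c3
  rw [htr] at hsum
  refine HasDerivWithinAt.mono_of_mem_nhdsWithin ?_ (Ico_mem_nhdsGE hΞ.pos)
  refine hsum.congr_of_mem (fun e he => ?_) h0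
  rw [trace_eq (habs e he), show 2 * m * Real.pi = (2 * p : ℕ) * (2 * s) by rw [hT]; ring]
  rfl

theorem exists_isEvenFamily_of_le {m p : ℕ} (hp : 1 ≤ p) (hpm : p ≤ ⌊Real.sqrt 8 * m⌋₊) :
    ∃ e₀ Ξ, IsEvenFamily m p e₀ Ξ := by
  have hp0 : (0 : ℝ) < p := by exact_mod_cast hp
  have hle : (p : ℝ) ≤ Real.sqrt 8 * m :=
    (Nat.cast_le.2 hpm).trans (Nat.floor_le (by positivity))
  have hm0 : (0 : ℝ) < m := by
    by_contra! hcon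
    have : (m : ℝ) = 0 := le_antisymm hcon (Nat.cast_nonneg m)
    rw [this, mul_zero] at hle
    linarith
  -- Equality is impossible: it would make √2 = p/(2m) rational. Strictness is what small
  -- oscillations require.
  have hsq : (p : ℝ) ^ 2 < 8 * m ^ 2 := by
    have h1 : (p : ℝ) ^ 2 ≤ 8 * m ^ 2 := by
      have := pow_le_pow_left₀ hp0.le hle 2
      rwa [mul_pow, Real.sq_sqrt (by norm_num)] at this
    refine lt_of_le_of_ne h1 fun heq => ?_
    have hirr : Irrational (Real.sqrt 2) := irrational_sqrt_two
    refine hirr ⟨(p : ℚ) / (2 * m), ?_⟩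
    push_cast
    rw [eq_comm, Real.sqrt_eq_iff_mul_self_eq (by norm_num) (by positivity)]
    field_simp
    linarith
  set s := m * Real.pi / (2 * p) with hs
  have hs0 : 0 < s := by have := Real.pi_pos; positivity
  obtain ⟨ξ, hξ⟩ := exists_isQuarterPeriod hs0 (by
    have : Real.pi / (2 * s) = p / m := by
      have := Real.pi_pos
      rw [hs]; field_simp
    rw [this, div_pow, div_lt_iff₀ (by positivity)]
    exact hsq)
  exact hξ.exists_isEvenFamily hp (by rw [hs]; field_simp)

end TraceDerivative

end Sitnikov

theorem theorem4p3 (m p : ℕ) (hp : 1 ≤ p) (hpm : p ≤ ⌊Real.sqrt 8 * m⌋₊)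
    (hne : ∀ n : ℕ, 1 ≤ n → (p : ℝ) / m ≠ 1 / (2 * n)) :
    (∃ (e₀ : ℝ) (Ξ : ℝ → ℝ), Sitnikov.IsEvenFamily m p e₀ Ξ) ∧
      ∀ (e₀ : ℝ) (Ξ : ℝ → ℝ), Sitnikov.IsEvenFamily m p e₀ Ξ →
        HasDerivWithinAt (Sitnikov.trace m Ξ) 0 (Set.Ici 0) 0 := by
  -- For m = 0 the floor is 0, contradicting 1 ≤ p.
  have hm : 1 ≤ m := by
    rcases Nat.eq_zero_or_pos m with rfl | h
    · simp at hpm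
      omega
    · exact h
  exact ⟨Sitnikov.exists_isEvenFamily_of_le hp hpm,
    fun _ _ hΞ => Sitnikov.hasDerivWithinAt_trace hm hp hne hΞ⟩
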